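/- Let $\Sigma$ be a finite alphabet. $TL[F,P]$ has the formulas $a\mid F\phi\mid P\phi\mid\phi\lor\phi\mid\neg\phi$ ($a\in\Sigma$; strict future and strict past) and $TL[X_a,Y_a]$ has the formulas $a\mid\top\mid m\phi\mid\phi\lor\phi\mid\neg\phi$, where $m$ is one of the deterministic modalities $SP,EP$ (go to the first, last position), $X_a,Y_a$ (go to the next, previous $a$, strictly), $\widetilde X_a,\widetilde Y_a$ (the same, non-strictly), $X_1,Y_1$ (go to the next, previous position). A formula $\phi$ has the language $L(\phi)=\{w\in\Sigma^+: w,1\models\phi\}$, and $w\models\phi$ means $w\in L(\phi)$. A *ranker* is a formula $m_1\cdots m_k\top$; it accepts on $w$ at the position reached from position $1$ by $m_1,\dots,m_k$ (if it exists). $r;\phi$ denotes $r$ with its leaf $\top$ replaced by $\phi$; $\mathcal P^{<}(r),\mathcal P^{\le}(r),\mathcal P^{>}(r)$ are the usual recursively defined ranker directionality formulas, which, on a word where $r$ accepts at $p$, hold exactly at the positions $i<p$, $i\le p$, $i>p$. $\mathbf u$ is a ranker that accepts on no word. *Modal subformulas.* A modal formula is one of the form $F\phi$ or $P\phi$. $Sform(\xi)$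 is the set of modal subformulas of $\xi$ other than $\xi$, and $Iform(\xi)\subseteq Sform(\xi)$ is the set of immediate ones. $\mathrm{Mod}(\Phi)$ is the set of all modal subformulas of $\Phi$, including $\Phi$ if $\Phi$ is modal. A modal $\psi$ is *defined* in $w$ if it holds at some position of $w$; then $dPos_w(\psi)$ is the last such position if $\psi=F\phi$ and the first one if $\psi=P\phi$. *Region templates.* A region template of a finite set $\kappa$ of modal formulas is a finite nonempty sequence $r_1<\dots<r_m$ of regions with $\tau(r)\subseteq\kappa$, $\alpha(r)\subseteq\Sigma$ and two strict total orders $<^L,<^R$ on $\alpha(r)$ for each region $r$, such that F-regions ($\tau(r)\neq\emptyset$) and I-regions ($\tau(r)=\emptyset$) alternate, each $\zeta\in\kappa$ lies in $\tau(r)$ for exactly one region $r=reg(\zeta)$, and $|\alpha(r)|=1$ for F-regions. It is the region template of $w$ for $\kappa$ if $w$ is a concatenation $p_1\cdots p_m$ of possibly empty factors such that, for each $i$: if $r_i$ is an F-region then $p_i$ is one position and equals $dPos_w(\zeta)$ for all $\zeta\in\tau(r_i)$; $\alpha(r_i)$ is the set of letters of $p_i$; and $<^L,<^R$ are the orders of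 first appearance in $p_i$ from the left and from the right. *Parameters* of $\Phi$ are $\Delta\subseteq Sform(\Phi)$ and a map $\theta$ taking each $\psi\in \mathrm{Mod}(\Phi)$ to a region template of $Iform(\psi)\cap\Delta$. A word $w$ *conforms to* $\Delta,\theta$ if $\Delta$ is the set of $\psi\in Sform(\Phi)$ that are defined in $w$, and, for all $\psi\in \mathrm{Mod}(\Phi)$, $\theta(\psi)$ is the region template of $w$ for $Iform(\psi)\cap\Delta$. *The rankers.* Fix $\Delta,\theta$ and $\psi\in \mathrm{Mod}(\Phi)$, $\psi=F\phi$ or $\psi=P\phi$. For a region $r$ of $\theta(\psi)$ and a boolean combination $\chi$ of letters and of formulas in $Iform(\psi)$, let $A_\chi(r)\subseteq\alpha(r)$ be given by $A_a(r)=\alpha(r)\cap\{a\}$, $A_{\chi\lor\chi'}(r)=A_\chi(r)\cup A_{\chi'}(r)$, $A_{\neg\chi}(r)=\alpha(r)\setminus A_\chi(r)$, and, for modal $\zeta$, $A_\zeta(r)=\alpha(r)$ if $\zeta\in\Delta$ and $r\le reg(\zeta)$ (type $F$) resp. $r\ge reg(\zeta)$ (type $P$), and $A_\zeta(r)=\emptyset$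 otherwise; $Def(\chi)=\{(r,A_\chi(r)):A_\chi(r)\ne\emptyset\}$. If $Def(\phi)=\emptyset$, then $D(\psi)=\mathbf u$. If $\psi=F\phi$ and $(r,A)\in Def(\phi)$ has the greatest $r$, put $D(\psi)=D(\zeta);Y_1\top$ with some $\zeta\in\tau(r)$ if $r$ is an F-region; otherwise, with $p$ the $<^R$-least letter of $A$, put $D(\psi)=EP\,\widetilde Y_pY_1\top$ if $r$ is the last region, and $D(\psi)=D(\zeta);Y_pY_1\top$ with some $\zeta\in\tau(r')$ if $r'$ is the region after $r$. The case $\psi=P\phi$ is symmetric (least $r$, $SP$, $X$, $<^L$). *The validity formulas.* $Dvalid(\Delta)=\bigwedge_{\psi\in\Delta}D(\psi)\land\bigwedge_{\psi\in Sform(\Phi)\setminus\Delta}\neg D(\psi)$ and $Tvalid(\theta)=\bigwedge_{\psi\in \mathrm{Mod}(\Phi)}(Rvalid\land Avalid\land Bvalid)(\theta,\psi)$, where, for the template $\theta(\psi)$ with regions $r_1,\dots,r_m$ and one representative $\zeta_i\in\tau(r_i)$ for each F-region: - $Rvalid$ is the conjunction, over the F-regions $r_i$, of $D(\zeta);\mathcal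 P^{\le}(D(\xi))$ for all $\zeta,\xi\in\tau(r_i)$, of $D(\zeta_i);\mathcal P^{<}(D(\zeta_{i+2}))$ if $i+2\le m$, of $D(\zeta_i);\mathit{Atfirst}$ if $i=1$, and of $D(\zeta_i);\mathit{Atlast}$ if $i=m$ ($\mathit{Atfirst}=\neg\bigvee_aY_a\top$, $\mathit{Atlast}=\neg\bigvee_aX_a\top$). - For an I-region $r_i$ let $l_i(a)=SP\,\widetilde X_a\top$ if $i=1$ and $D(\zeta_{i-1});X_a\top$ otherwise, and $\rho_i(a)=EP\,\widetilde Y_a\top$ if $i=m$ and $D(\zeta_{i+1});Y_a\top$ otherwise. Let $occ_i(a)=l_i(a);\mathcal P^{<}(D(\zeta_{i+1}))$ (just $l_i(a)$ if $i=m$) for I-regions, and $occ_i(a)=D(\zeta_i);a$ for F-regions. $Avalid$ is $\bigwedge_i\big(\bigwedge_{a\in\alpha(r_i)}occ_i(a)\land\bigwedge_{a\notin\alpha(r_i)}\neg occ_i(a)\big)$. - $Bvalid$ is the conjunction, over the I-regions $r_i$, of $l_i(b);\mathcal P^{<}(l_i(b'))$ for $b,b'$ consecutive in $<^L$, and of $\rho_i(b);\mathcal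 P^{>}(\rho_i(b'))$ for $b,b'$ consecutive in $<^R$. *The translation.* $Trans(\Phi)=\bigvee_{\Delta,\theta}\big[Dvalid(\Delta)\land Tvalid(\theta)\land\mathcal B\big]$, over all parameters of $\Phi$, where $\mathcal B$ is $\Phi$, read as a boolean combination of letters and outermost modal formulas, with every outermost $F\phi$ replaced by the ranker $D(F\phi)$ and every outermost $P\phi$ (false at the first position) replaced by $\neg\top$. **Statement.** For every $TL[F,P]$ formula $\Phi$: (i) for all parameters $\Delta,\theta$ of $\Phi$ and all $w\in\Sigma^+$, $w$ conforms to $\Delta,\theta$ if and only if $w\models Dvalid(\Delta)$ and $w\models Tvalid(\theta)$; (ii) for all parameters $\Delta,\theta$ of $\Phi$, every modal subformula $\psi\in\mathrm{Mod}(\Phi)$, every $w\in\Sigma^+$ that conforms to $\Delta,\theta$, and every position $i$, the ranker $D(\psi)$ accepts on $w$ at $i$ if and only if $\psi$ is defined in $w$ and $dPos_w(\psi)=i$; (iii) $L(Trans(\Phi))=L(\Phi)$. -/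

import Mathlib

/-! Words over `σ` are lists; a position of `w` is an index `i < w.length` (the first one is `0`),
and `w[i]? = some a` says that `i` is a position of `w` carrying the letter `a`. -/

namespace UL

/-! ### The logic TL[F,P] -/

/-- Formulas of TL[F,P]. -/
inductive TLFP (σ : Type*) where
  | letter (a : σ) : TLFP σ
  | F (φ : TLFP σ) : TLFP σ
  | P (φ : TLFP σ) : TLFP σ
  | or (φ₁ φ₂ : TLFP σ) : TLFP σ
  | not (φ : TLFP σ) : TLFP σ
  deriving DecidableEq

namespace TLFP

variable {σ : Type*}

/-- `w, i ⊨ φ` for a position `i` of `w`. -/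
def Sat (w : List σ) : ℕ → TLFP σ → Prop
  | i, letter a => w[i]? = some a
  | i, F φ => ∃ j, i < j ∧ j < w.length ∧ Sat w j φ
  | i, P φ => ∃ j, j < i ∧ Sat w j φ
  | i, or φ₁ φ₂ => Sat w i φ₁ ∨ Sat w i φ₂
  | i, not φ => ¬ Sat w i φ

/-- The words whose first position satisfies `φ`; the empty word has no position. -/
def language (φ : TLFP σ) : Set (List σ) := {w | w ≠ [] ∧ Sat w 0 φ}

/-- Number of symbols of a formula. -/
def size : TLFP σ → ℕ
  | letter _ => 1
  | F φ => size φ + 1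
  | P φ => size φ + 1
  | or φ₁ φ₂ => size φ₁ + size φ₂ + 1
  | not φ => size φ + 1

/-- A modal formula `ψ` (of type `F` or `P`) is defined in `w` if it holds somewhere in `w`. -/
def Defined (w : List σ) (ψ : TLFP σ) : Prop := ∃ i, i < w.length ∧ Sat w i ψ

/-- `i` is the defining position of the modal formula `ψ` in `w`: the last position where an
`F`-type formula holds, the first position where a `P`-type formula holds. -/
def IsDPos (w : List σ) : TLFP σ → ℕ → Prop
  | F φ, i => i < w.length ∧ Sat w i (F φ) ∧ ∀ j, i < j → j < w.length → ¬ Sat w j (F φ)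
  | P φ, i => i < w.length ∧ Sat w i (P φ) ∧ ∀ j, j < i → ¬ Sat w j (P φ)
  | _, _ => False

variable [DecidableEq σ]

/-- All modal subformulas of a formula, the formula itself included if it is modal. -/
def modals : TLFP σ → Finset (TLFP σ)
  | letter _ => ∅
  | F φ => insert (F φ) (modals φ)
  | P φ => insert (P φ) (modals φ)
  | or φ₁ φ₂ => modals φ₁ ∪ modals φ₂
  | not φ => modals φ

/-- `Sform ξ`: the modal subformulas of `ξ`, excluding `ξ`. -/
def sform (ξ : TLFP σ) : Finset (TLFP σ) := (modals ξ).erase ξ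

/-- The modal formulas of which `φ` is (together with letters) a boolean combination. -/
def components : TLFP σ → Finset (TLFP σ)
  | letter _ => ∅
  | F φ => {F φ}
  | P φ => {P φ}
  | or φ₁ φ₂ => components φ₁ ∪ components φ₂
  | not φ => components φ

/-- `Iform ξ`: the immediate modal subformulas of `ξ`. -/
def iform : TLFP σ → Finset (TLFP σ)
  | F φ => components φ
  | P φ => components φ
  | ξ => components ξ

theorem components_subset_modals (φ : TLFP σ) : components φ ⊆ modals φ := by
  induction φ with
  | letter a => simp [components]
  | F φ ih => simp [components, modals]
  | P φ ih => simp [components, modals]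
  | or φ₁ φ₂ h₁ h₂ => exact Finset.union_subset_union h₁ h₂
  | not φ ih => exact ih

theorem modals_trans {Φ ψ : TLFP σ} (h : ψ ∈ modals Φ) : modals ψ ⊆ modals Φ := by
  induction Φ with
  | letter a => simp [modals] at h
  | F φ ih =>
    rcases Finset.mem_insert.1 h with rfl | h
    · exact subset_rfl
    · exact (ih h).trans (Finset.subset_insert _ _)
  | P φ ih =>
    rcases Finset.mem_insert.1 h with rfl | h
    · exact subset_rfl
    · exact (ih h).trans (Finset.subset_insert _ _)
  | or φ₁ φ₂ h₁ h₂ =>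
    rcases Finset.mem_union.1 h with h | h
    · exact (h₁ h).trans Finset.subset_union_left
    · exact (h₂ h).trans Finset.subset_union_right
  | not φ ih => exact ih h

theorem iform_subset_modals (ψ : TLFP σ) : iform ψ ⊆ modals ψ := by
  cases ψ with
  | F φ => exact (components_subset_modals φ).trans (Finset.subset_insert _ _)
  | P φ => exact (components_subset_modals φ).trans (Finset.subset_insert _ _)
  | letter a => exact components_subset_modals _
  | or φ₁ φ₂ => exact components_subset_modals _
  | not φ => exact components_subset_modals _

theorem size_le_of_mem_modals {ζ φ : TLFP σ} (h : ζ ∈ modals φ) : size ζ ≤ size φ := by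
  induction φ with
  | letter a => simp [modals] at h
  | F φ ih =>
    rcases Finset.mem_insert.1 h with rfl | h
    · exact le_rfl
    · exact (ih h).trans (Nat.le_succ _)
  | P φ ih =>
    rcases Finset.mem_insert.1 h with rfl | h
    · exact le_rfl
    · exact (ih h).trans (Nat.le_succ _)
  | or φ₁ φ₂ h₁ h₂ =>
    rcases Finset.mem_union.1 h with h | h
    · have := h₁ h
      simp only [size]; omega
    · have := h₂ h
      simp only [size]; omega
  | not φ ih => exact (ih h).trans (Nat.le_succ _)

theorem size_lt_of_mem_iform {Φ ψ ζ : TLFP σ} (hψ : ψ ∈ modals Φ) (h : ζ ∈ iform ψ) :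
    size ζ < size ψ := by
  have key : (∃ φ, ψ = F φ) ∨ (∃ φ, ψ = P φ) := by
    induction Φ with
    | letter a => simp [modals] at hψ
    | F φ ih =>
      rcases Finset.mem_insert.1 hψ with rfl | hψ
      · exact Or.inl ⟨φ, rfl⟩
      · exact ih hψ
    | P φ ih =>
      rcases Finset.mem_insert.1 hψ with rfl | hψ
      · exact Or.inr ⟨φ, rfl⟩
      · exact ih hψ
    | or φ₁ φ₂ h₁ h₂ =>
      rcases Finset.mem_union.1 hψ with hψ | hψ
      · exact h₁ hψ
      · exact h₂ hψ
    | not φ ih => exact ih hψ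
  rcases key with ⟨φ, rfl⟩ | ⟨φ, rfl⟩
  · exact Nat.lt_succ_of_le (size_le_of_mem_modals (components_subset_modals φ h))
  · exact Nat.lt_succ_of_le (size_le_of_mem_modals (components_subset_modals φ h))

end TLFP

/-! ### The logic TL[X_a,Y_a] -/

/-- The modalities `SP`, `EP`, `X_a`, `Y_a`, their weak versions, and `X_1`, `Y_1`. -/
inductive Modality (σ : Type*) where
  | SP : Modality σ
  | EP : Modality σ
  | X (a : σ) : Modality σ
  | Y (a : σ) : Modality σ
  | WX (a : σ) : Modality σ
  | WY (a : σ) : Modality σ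
  | X1 : Modality σ
  | Y1 : Modality σ

/-- `m.Step w i j`: from position `i` of `w` the modality `m` accesses position `j`. -/
def Modality.Step {σ : Type*} (w : List σ) : Modality σ → ℕ → ℕ → Prop
  | SP, _, j => j = 0 ∧ j < w.length
  | EP, _, j => j + 1 = w.length
  | X a, i, j => i < j ∧ w[j]? = some a ∧ ∀ k, i < k → k < j → w[k]? ≠ some a
  | Y a, i, j => j < i ∧ w[j]? = some a ∧ ∀ k, j < k → k < i → w[k]? ≠ some a
  | WX a, i, j => i ≤ j ∧ w[j]? = some a ∧ ∀ k, i ≤ k → k < j → w[k]? ≠ some a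
  | WY a, i, j => j ≤ i ∧ w[j]? = some a ∧ ∀ k, j < k → k ≤ i → w[k]? ≠ some a
  | X1, i, j => j = i + 1 ∧ j < w.length
  | Y1, i, j => j + 1 = i ∧ j < w.length

/-- Formulas of TL[X_a,Y_a]. -/
inductive TLXY (σ : Type*) where
  | letter (a : σ) : TLXY σ
  | top : TLXY σ
  | mod (m : Modality σ) (φ : TLXY σ) : TLXY σ
  | or (φ₁ φ₂ : TLXY σ) : TLXY σ
  | not (φ : TLXY σ) : TLXY σ

namespace TLXY

variable {σ : Type*}

/-- `w, i ⊨ φ` for a position `i` of `w`. -/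
def Sat (w : List σ) : ℕ → TLXY σ → Prop
  | i, letter a => w[i]? = some a
  | _, top => True
  | i, mod m φ => ∃ j, m.Step w i j ∧ Sat w j φ
  | i, or φ₁ φ₂ => Sat w i φ₁ ∨ Sat w i φ₂
  | i, not φ => ¬ Sat w i φ

/-- The words whose first position satisfies `φ`; the empty word has no position. -/
def language (φ : TLXY σ) : Set (List σ) := {w | w ≠ [] ∧ Sat w 0 φ}

/-- Falsity. -/
def bot : TLXY σ := not top

/-- Conjunction. -/
def and (φ₁ φ₂ : TLXY σ) : TLXY σ := not (or (not φ₁) (not φ₂))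

/-- Finite conjunction. -/
noncomputable def bigAnd {ι : Type*} (s : Finset ι) (f : ι → TLXY σ) : TLXY σ :=
  (s.toList.map f).foldr and top

/-- Finite disjunction. -/
noncomputable def bigOr {ι : Type*} (s : Finset ι) (f : ι → TLXY σ) : TLXY σ :=
  (s.toList.map f).foldr or bot

/-- Holds exactly at the first position. -/
noncomputable def atFirst [Fintype σ] : TLXY σ :=
  not (bigOr Finset.univ fun a => mod (.Y a) top)

/-- Holds exactly at the last position. -/
noncomputable def atLast [Fintype σ] : TLXY σ :=
  not (bigOr Finset.univ fun a => mod (.X a) top)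

end TLXY

/-! ### Ranker formulas -/

/-- A ranker formula `m₁ m₂ … mₖ ⊤` is given by its sequence of modalities. -/
abbrev Ranker (σ : Type*) := List (Modality σ)

namespace Ranker

variable {σ : Type*}

/-- `r.comp φ` is `r;φ`: the leaf `⊤` of the ranker formula `r` is replaced by `φ`. -/
def comp (r : Ranker σ) (φ : TLXY σ) : TLXY σ := r.foldr TLXY.mod φ

/-- The ranker as a formula. -/
def toTLXY (r : Ranker σ) : TLXY σ := comp r .top

/-- Started at position `i` of `w`, the ranker ends at position `j`. -/
def Run (w : List σ) : Ranker σ → ℕ → ℕ → Prop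
  | [], i, j => i = j
  | m :: r, i, j => ∃ k, m.Step w i k ∧ Run w r k j

/-- The ranker, evaluated from the first position of `w`, accepts at position `i`, which is then
the position of its leaf. -/
def AcceptsAt (r : Ranker σ) (w : List σ) (i : ℕ) : Prop := w ≠ [] ∧ Run w r 0 i

/-- A ranker that accepts on no word. -/
def u : Ranker σ := [.SP, .Y1]

/-- The four ranker directionality formulas of a ranker. -/
structure Directionality (σ : Type*) where
  lt : TLXY σ
  le : TLXY σ
  gt : TLXY σ
  ge : TLXY σ

variable [Fintype σ]

open TLXY in
/-- The directionality formulas, by recursion on the ranker read from its last modality; the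
trivial ranker ends at the first position, as `SP` does. -/
noncomputable def dirRev : List (Modality σ) → Directionality σ
  | [] => ⟨bot, atFirst, not atFirst, top⟩
  | .SP :: _ => ⟨bot, atFirst, not atFirst, top⟩
  | .EP :: _ => ⟨not atLast, top, bot, atLast⟩
  | .WX a :: r =>
    let le := or (not (mod (.Y a) top)) (mod (.Y a) (dirRev r).lt)
    let gt := mod (.Y a) (dirRev r).ge
    ⟨mod (.X a) le, le, gt, or (not (mod (.X a) top)) (mod (.X a) gt)⟩
  | .X a :: r =>
    let le := or (not (mod (.Y a) top)) (mod (.Y a) (dirRev r).le)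
    let gt := mod (.Y a) (dirRev r).gt
    ⟨mod (.X a) le, le, gt, or (not (mod (.X a) top)) (mod (.X a) gt)⟩
  | .WY a :: r =>
    let lt := mod (.X a) (dirRev r).le
    let ge := or (not (mod (.X a) top)) (mod (.X a) (dirRev r).gt)
    ⟨lt, or (not (mod (.Y a) top)) (mod (.Y a) lt), mod (.Y a) ge, ge⟩
  | .Y a :: r =>
    let lt := mod (.X a) (dirRev r).lt
    let ge := or (not (mod (.X a) top)) (mod (.X a) (dirRev r).ge)
    ⟨lt, or (not (mod (.Y a) top)) (mod (.Y a) lt), mod (.Y a) ge, ge⟩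
  | .X1 :: r =>
    ⟨(dirRev r).le, or atFirst (mod .Y1 (dirRev r).le), mod .Y1 (dirRev r).gt, (dirRev r).gt⟩
  | .Y1 :: r =>
    ⟨mod .X1 (dirRev r).lt, (dirRev r).lt, (dirRev r).ge, or atLast (mod .X1 (dirRev r).ge)⟩

/-- `𝒫^<(r)`. -/
noncomputable def before (r : Ranker σ) : TLXY σ := (dirRev r.reverse).lt

/-- `𝒫^≤(r)`. -/
noncomputable def upTo (r : Ranker σ) : TLXY σ := (dirRev r.reverse).le

/-- `𝒫^>(r)`. -/
noncomputable def after (r : Ranker σ) : TLXY σ := (dirRev r.reverse).gt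

end Ranker

/-! ### Region templates -/

/-- A region template of a finite set `κ` of modal formulas: the regions are
`0 < 1 < … < m - 1`; the F-regions are those with `τ i ≠ ∅`, the others are the I-regions. The
strict total orders `<^L` and `<^R` on `alpha i` are given by the increasing enumerations `left i`
and `right i` of `alpha i`. -/
structure RegionTemplate {σ : Type*} (κ : Finset (TLFP σ)) where
  m : ℕ
  m_pos : 0 < m
  τ : Fin m → Finset κ
  alternate : ∀ i j : Fin m, i.val + 1 = j.val → ((τ i).Nonempty ↔ ¬ (τ j).Nonempty)
  unique : ∀ ζ : κ, ∃! i, ζ ∈ τ i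
  alpha : Fin m → Finset σ
  alpha_card : ∀ i, (τ i).Nonempty → (alpha i).card = 1
  left : Fin m → List σ
  left_nodup : ∀ i, (left i).Nodup
  mem_left : ∀ i a, a ∈ left i ↔ a ∈ alpha i
  right : Fin m → List σ
  right_nodup : ∀ i, (right i).Nodup
  mem_right : ∀ i a, a ∈ right i ↔ a ∈ alpha i

namespace RegionTemplate

variable {σ : Type*} {κ : Finset (TLFP σ)}

/-- The F-region of a formula of `κ`. -/
noncomputable def reg (R : RegionTemplate κ) (ζ : κ) : Fin R.m := (R.unique ζ).choose

/-- `R` is the region template of `w` for `κ`: the word is cut into consecutive, possibly empty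
intervals `[c i, c (i + 1))`, one for each region `i` of `R`. -/
def IsTemplateOf (R : RegionTemplate κ) (w : List σ) : Prop :=
  ∃ c : ℕ → ℕ, c 0 = 0 ∧ c R.m = w.length ∧ (∀ i : Fin R.m, c i ≤ c (i + 1)) ∧
    (∀ i : Fin R.m, (R.τ i).Nonempty →
      c (i + 1) = c i + 1 ∧ ∀ ζ ∈ R.τ i, TLFP.IsDPos w ζ.1 (c i)) ∧
    (∀ (i : Fin R.m) (a : σ),
      a ∈ R.alpha i ↔ ∃ k, c i ≤ k ∧ k < c (i + 1) ∧ w[k]? = some a) ∧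
    (∀ i : Fin R.m, (R.left i).Pairwise fun a b =>
      ∃ k, c i ≤ k ∧ k < c (i + 1) ∧ w[k]? = some a ∧
        ∀ l, c i ≤ l → l ≤ k → w[l]? ≠ some b) ∧
    (∀ i : Fin R.m, (R.right i).Pairwise fun a b =>
      ∃ k, c i ≤ k ∧ k < c (i + 1) ∧ w[k]? = some a ∧
        ∀ l, k ≤ l → l < c (i + 1) → w[l]? ≠ some b)

theorem m_le (R : RegionTemplate κ) : R.m ≤ 2 * κ.card + 1 := by
  classical
  have hF : ∀ k : Fin (R.m / 2), ∃ ζ : κ, (R.reg ζ).val / 2 = k.val := by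
    intro k
    have hk := k.2
    have h0 : 2 * k.val < R.m := by omega
    have h1 : 2 * k.val + 1 < R.m := by omega
    have halt := R.alternate ⟨2 * k.val, h0⟩ ⟨2 * k.val + 1, h1⟩ rfl
    have hreg : ∀ (ζ : κ) (i : Fin R.m), ζ ∈ R.τ i → R.reg ζ = i := fun ζ i hi =>
      ((R.unique ζ).choose_spec.2 i hi).symm
    by_cases h : (R.τ ⟨2 * k.val, h0⟩).Nonempty
    · obtain ⟨ζ, hζ⟩ := h
      refine ⟨ζ, ?_⟩
      rw [hreg ζ _ hζ]
      simp
    · have h' : (R.τ ⟨2 * k.val + 1, h1⟩).Nonempty := by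
        by_contra hc
        exact h (halt.2 hc)
      obtain ⟨ζ, hζ⟩ := h'
      refine ⟨ζ, ?_⟩
      rw [hreg ζ _ hζ]
      simp only
      omega
  choose f hf using hF
  have hinj : Function.Injective f := by
    intro k l h
    apply Fin.ext
    rw [← hf k, ← hf l, h]
  have := Fintype.card_le_of_injective f hinj
  simp only [Fintype.card_fin, Fintype.card_coe] at this
  omega

instance finite [Finite σ] : Finite (RegionTemplate κ) := by
  classical
  have := Fintype.ofFinite σ
  let T := Σ m : Fin (2 * κ.card + 2), (Fin m → Finset κ) × (Fin m → Finset σ) ×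
    (Fin m → {l : List σ // l.Nodup}) × (Fin m → {l : List σ // l.Nodup})
  let f : RegionTemplate κ → T := fun R =>
    ⟨⟨R.m, Nat.lt_succ_of_le R.m_le⟩, R.τ, R.alpha, fun i => ⟨R.left i, R.left_nodup i⟩,
      fun i => ⟨R.right i, R.right_nodup i⟩⟩
  refine Finite.of_injective f ?_
  rintro ⟨m, h1, τ, h2, h3, al, h4, l, h5, h6, r, h7, h8⟩
    ⟨m', g1, τ', g2, g3, al', g4, l', g5, g6, r', g7, g8⟩ h
  have hm : m = m' := congrArg (fun t : T => t.1.val) h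
  subst hm
  have h' := eq_of_heq (Sigma.mk.inj_iff.1 h).2
  simp only [Prod.mk.injEq] at h'
  obtain ⟨rfl, rfl, hl, hr⟩ := h'
  have hl' : l = l' := funext fun i => congrArg Subtype.val (congrFun hl i)
  have hr' : r = r' := funext fun i => congrArg Subtype.val (congrFun hr i)
  subst hl' hr'
  rfl

/-! The constructions below use rankers `D ζ` for the formulas `ζ` of `κ`. -/

variable (R : RegionTemplate κ) (D : κ → Ranker σ)

open Classical in
/-- The ranker of (a formula of) the F-region `i`. -/
noncomputable def regRanker (i : Fin R.m) : Ranker σ :=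
  if h : (R.τ i).Nonempty then D h.choose else Ranker.u

/-- Go to the first `b` to the right of the left border of the I-region `i`. -/
noncomputable def fromLeft (i : Fin R.m) (b : σ) : Ranker σ :=
  if i.val = 0 then [.SP, .WX b]
  else R.regRanker D ⟨i.val - 1, lt_of_le_of_lt (Nat.sub_le _ _) i.2⟩ ++ [.X b]

/-- Go to the last `b` to the left of the right border of the I-region `i`. -/
noncomputable def fromRight (i : Fin R.m) (b : σ) : Ranker σ :=
  if h : i.val + 1 < R.m then R.regRanker D ⟨i.val + 1, h⟩ ++ [.Y b]
  else [.EP, .WY b]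

section Def

variable [DecidableEq σ]

open Classical in
/-- The set `Def(φ)` of pairs `(r, A)` for a boolean combination `φ` of letters and modal formulas:
the value at `r` is the set `A ⊆ alpha r` of the letters at which `φ` holds inside region `r`,
and `(r, A)` is a member of `Def(φ)` if `A ≠ ∅`. A modal formula outside `κ` holds nowhere. -/
noncomputable def defAt : TLFP σ → Fin R.m → Finset σ
  | .letter a, r => R.alpha r ∩ {a}
  | .or φ₁ φ₂, r => defAt φ₁ r ∪ defAt φ₂ r
  | .not φ, r => R.alpha r \ defAt φ r
  | .F φ, r => if ∃ h : TLFP.F φ ∈ κ, r ≤ R.reg ⟨_, h⟩ then R.alpha r else ∅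
  | .P φ, r => if ∃ h : TLFP.P φ ∈ κ, R.reg ⟨_, h⟩ ≤ r then R.alpha r else ∅

/-- The regions that occur in `Def(φ)`. -/
noncomputable def defRegions (φ : TLFP σ) : Finset (Fin R.m) :=
  Finset.univ.filter fun r => (R.defAt φ r).Nonempty

open Classical in
/-- The ranker of a modal formula `ψ` whose region template is `R`: one position before the last
position given by `Def(φ)` if `ψ = F φ`, one position after the first one if `ψ = P φ`. -/
noncomputable def rankerStep : TLFP σ → Ranker σ
  | .F φ =>
    if h : (R.defRegions φ).Nonempty then
      let r := (R.defRegions φ).max' h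
      if (R.τ r).Nonempty then R.regRanker D r ++ [.Y1]
      else
        match (R.right r).find? (fun a => a ∈ R.defAt φ r) with
        | some p => R.fromRight D r p ++ [.Y1]
        | none => Ranker.u
    else Ranker.u
  | .P φ =>
    if h : (R.defRegions φ).Nonempty then
      let r := (R.defRegions φ).min' h
      if (R.τ r).Nonempty then R.regRanker D r ++ [.X1]
      else
        match (R.left r).find? (fun a => a ∈ R.defAt φ r) with
        | some p => R.fromLeft D r p ++ [.X1]
        | none => Ranker.u
    else Ranker.u
  | _ => Ranker.u

end Def

section Checks

variable [Fintype σ]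

open TLXY Ranker

/-- The rankers of all formulas of the F-region `r` accept at the same position. -/
noncomputable def tauChk (r : Fin R.m) : TLXY σ :=
  bigAnd (R.τ r) fun ζ => bigAnd (R.τ r) fun ξ =>
    and (comp (D ζ) (upTo (D ξ))) (comp (D ξ) (upTo (D ζ)))

/-- The F-region `r` precedes the next F-region; if there is no region to its left (right), it
is the first (last) position of the word. -/
noncomputable def ordChk (r : Fin R.m) : TLXY σ :=
  and (if h : r.val + 2 < R.m then
        comp (R.regRanker D r) (before (R.regRanker D ⟨r.val + 2, h⟩)) else top)
    (and (if r.val = 0 then comp (R.regRanker D r) atFirst else top)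
      (if r.val + 1 = R.m then comp (R.regRanker D r) atLast else top))

open Classical in
/-- The formula `Rvalid`. -/
noncomputable def rvalid : TLXY σ :=
  bigAnd Finset.univ fun r : Fin R.m =>
    if (R.τ r).Nonempty then and (R.tauChk D r) (R.ordChk D r) else top

open Classical in
/-- The letter `a` occurs in region `r`. -/
noncomputable def occurs (r : Fin R.m) (a : σ) : TLXY σ :=
  if (R.τ r).Nonempty then comp (R.regRanker D r) (letter a)
  else comp (R.fromLeft D r a)
    (if h : r.val + 1 < R.m then before (R.regRanker D ⟨r.val + 1, h⟩) else top)

open Classical in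
/-- The formula `Avalid`. -/
noncomputable def avalid : TLXY σ :=
  bigAnd Finset.univ fun r : Fin R.m =>
    and (bigAnd (R.alpha r) fun a => R.occurs D r a)
      (bigAnd (Finset.univ \ R.alpha r) fun a => not (R.occurs D r a))

/-- Consecutive letters of the list are first reached in this order from the left. -/
noncomputable def lOrdChk (r : Fin R.m) : List σ → TLXY σ
  | a :: b :: l =>
    and (comp (R.fromLeft D r a) (before (R.fromLeft D r b))) (lOrdChk r (b :: l))
  | _ => top

/-- Consecutive letters of the list are first reached in this order from the right. -/
noncomputable def rOrdChk (r : Fin R.m) : List σ → TLXY σ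
  | a :: b :: l =>
    and (comp (R.fromRight D r a) (after (R.fromRight D r b))) (rOrdChk r (b :: l))
  | _ => top

open Classical in
/-- The formula `Bvalid`; there is nothing to check in an F-region. -/
noncomputable def bvalid : TLXY σ :=
  bigAnd Finset.univ fun r : Fin R.m =>
    if (R.τ r).Nonempty then top
    else and (R.lOrdChk D r (R.left r)) (R.rOrdChk D r (R.right r))

end Checks

end RegionTemplate

/-! ### Parameters, validity formulas and the translation -/

/-- Parameters `Δ, θ` of `Φ`. -/
structure Params {σ : Type*} [DecidableEq σ] (Φ : TLFP σ) where
  Δ : Finset (TLFP σ)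
  Δ_subset : Δ ⊆ Φ.sform
  θ : (ψ : Φ.modals) → RegionTemplate (ψ.1.iform ∩ Δ)

namespace Params

variable {σ : Type*} [DecidableEq σ] {Φ : TLFP σ}

instance finite [Finite σ] : Finite (Params Φ) := by
  let T := Σ Δ : {Δ // Δ ∈ Φ.sform.powerset}, ((ψ : Φ.modals) → RegionTemplate (ψ.1.iform ∩ Δ.1))
  refine Finite.of_injective
    (fun p : Params Φ => (⟨⟨p.Δ, Finset.mem_powerset.2 p.Δ_subset⟩, p.θ⟩ : T)) ?_
  rintro ⟨Δ, h, θ⟩ ⟨Δ', h', θ'⟩ e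
  have hΔ : Δ = Δ' := congrArg (fun t : T => t.1.1) e
  subst hΔ
  simp only [Sigma.mk.injEq, heq_eq_eq, true_and] at e
  subst e
  rfl

/-- `w` conforms to `Δ, θ`. -/
def Conforms (p : Params Φ) (w : List σ) : Prop :=
  (∀ ψ ∈ Φ.sform, ψ ∈ p.Δ ↔ ψ.Defined w) ∧ ∀ ψ : Φ.modals, (p.θ ψ).IsTemplateOf w

/-- The ranker `D(ψ)` of a modal subformula `ψ` of `Φ`. -/
noncomputable def ranker (p : Params Φ) (ψ : Φ.modals) : Ranker σ :=
  (p.θ ψ).rankerStep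
    (fun ζ => ranker p ⟨ζ.1, TLFP.modals_trans ψ.2
      (TLFP.iform_subset_modals ψ.1 (Finset.mem_inter.1 ζ.2).1)⟩) ψ.1
termination_by ψ.1.size
decreasing_by exact TLFP.size_lt_of_mem_iform ψ.2 (Finset.mem_inter.1 ζ.2).1

/-- The rankers of the formulas that occur in the region template of `ψ`. -/
noncomputable def innerRanker (p : Params Φ) (ψ : Φ.modals)
    (ζ : ↥(ψ.1.iform ∩ p.Δ)) : Ranker σ :=
  p.ranker ⟨ζ.1, TLFP.modals_trans ψ.2
    (TLFP.iform_subset_modals ψ.1 (Finset.mem_inter.1 ζ.2).1)⟩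

open TLXY

/-- The formula `Dvalid(Δ)`. -/
noncomputable def dvalid (p : Params Φ) : TLXY σ :=
  and (bigAnd (Φ.modals.attach.filter fun ψ => ψ.1 ∈ p.Δ) fun ψ => (p.ranker ψ).toTLXY)
    (bigAnd (Φ.modals.attach.filter fun ψ => ψ.1 ∈ Φ.sform \ p.Δ) fun ψ =>
      not (p.ranker ψ).toTLXY)

/-- The formula `Tvalid(θ)`. -/
noncomputable def tvalid [Fintype σ] (p : Params Φ) : TLXY σ :=
  bigAnd Φ.modals.attach fun ψ =>
    and ((p.θ ψ).rvalid (p.innerRanker ψ))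
      (and ((p.θ ψ).avalid (p.innerRanker ψ)) ((p.θ ψ).bvalid (p.innerRanker ψ)))

/-- The boolean combination `φ` of letters and modal subformulas of `Φ`, with each `F`-type modal
formula replaced by its ranker; a `P`-type formula is false at the first position. -/
noncomputable def topLevel (p : Params Φ) : TLFP σ → TLXY σ
  | .letter a => letter a
  | .F φ => if h : TLFP.F φ ∈ Φ.modals then (p.ranker ⟨_, h⟩).toTLXY else bot
  | .P _ => bot
  | .or φ₁ φ₂ => or (topLevel p φ₁) (topLevel p φ₂)
  | .not φ => not (topLevel p φ)

end Params

open TLXY in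
/-- The formula `Trans(Φ)`: a disjunction over all parameters of `Φ`. -/
noncomputable def trans {σ : Type*} [Fintype σ] [DecidableEq σ] (Φ : TLFP σ) : TLXY σ :=
  letI := Fintype.ofFinite (Params Φ)
  bigOr (Finset.univ : Finset (Params Φ)) fun p =>
    and p.dvalid (and p.tvalid (p.topLevel Φ))

end UL

namespace UL

variable {σ : Type*}

/-! ### Determinism of the modalities; nearest occurrences of a letter. -/

namespace Modality

/-! The truth set of `F φ` is an initial segment of the word and that of `P φ` a final segment, so a
defined modal formula is known everywhere once its defining position is known. Cut the word at the
defining positions of the immediate modal subformulas of `ψ = F φ`. Inside one piece none of them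
changes its value, so whether `φ` holds at a position depends only on the letter there
(`IsCut.sat_iff_mem_defAt`). The last position satisfying `φ` therefore lies in the last region with
a satisfying letter, and it is the last occurrence there of the satisfying letter that comes first
in `<^R`. A ranker reaches it from the next cut point, and one step back is the defining position of
`ψ` (`IsCut.run_rankerStep_F`; `P` is the mirror image).

Conversely, suppose that the rankers of the immediate subformulas accept exactly at the defining
positions. Then the directionality formulas compare positions with the cut points, and the three
validity formulas say precisely that the template is that of the word (`isTemplateOf_iff_sat`).

These two facts alternate in an induction on the size of `ψ`. In (i), from validity to conformity,
correct inner rankers turn `tvalid` into a true template for `ψ` and `dvalid` into true membership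
in `Δ` for the immediate subformulas, which makes the ranker of `ψ` correct (`Params.conforms_iff`).
If conformity is given, the same induction step yields (ii). For (iii), every word conforms to some
parameters (`Params.exists_conforms`), and under conformity the top-level formula is equivalent to
`Φ` at the first position (`Conforms.sat_topLevel`). -/

theorem Step.unique {w : List σ} {m : Modality σ} {i j k : ℕ} (hj : m.Step w i j)
    (hk : m.Step w i k) : j = k := by
  cases m with
  | SP => exact hj.1.trans hk.1.symm
  | EP => simp only [Step] at hj hk; omega
  | X1 => exact hj.1.trans hk.1.symm
  | Y1 => have h₁ := hj.1; have h₂ := hk.1; omega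
  | X a =>
    obtain ⟨h₁, h₂, h₃⟩ := hj
    obtain ⟨g₁, g₂, g₃⟩ := hk
    rcases lt_trichotomy j k with h | h | h
    · exact absurd h₂ (g₃ _ h₁ h)
    · exact h
    · exact absurd g₂ (h₃ _ g₁ h)
  | Y a =>
    obtain ⟨h₁, h₂, h₃⟩ := hj
    obtain ⟨g₁, g₂, g₃⟩ := hk
    rcases lt_trichotomy j k with h | h | h
    · exact absurd g₂ (h₃ _ h g₁)
    · exact h
    · exact absurd h₂ (g₃ _ h h₁)
  | WX a =>
    obtain ⟨h₁, h₂, h₃⟩ := hj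
    obtain ⟨g₁, g₂, g₃⟩ := hk
    rcases lt_trichotomy j k with h | h | h
    · exact absurd h₂ (g₃ _ h₁ h)
    · exact h
    · exact absurd g₂ (h₃ _ g₁ h)
  | WY a =>
    obtain ⟨h₁, h₂, h₃⟩ := hj
    obtain ⟨g₁, g₂, g₃⟩ := hk
    rcases lt_trichotomy j k with h | h | h
    · exact absurd g₂ (h₃ _ h g₁)
    · exact h
    · exact absurd h₂ (g₃ _ h h₁)

theorem Step.lt_length {w : List σ} {m : Modality σ} {i j : ℕ} (h : m.Step w i j) :
    j < w.length := by
  have key : ∀ {a}, w[j]? = some a → j < w.length := fun h => (List.getElem?_eq_some_iff.1 h).1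
  cases m with
  | SP => exact h.2
  | EP => simp only [Step] at h; omega
  | X1 => exact h.2
  | Y1 => exact h.2
  | X a => exact key h.2.1
  | Y a => exact key h.2.1
  | WX a => exact key h.2.1
  | WY a => exact key h.2.1

end Modality

theorem exists_first_letter {w : List σ} {a : σ} {l k : ℕ} (hl : l ≤ k) (hk : w[k]? = some a) :
    ∃ j, l ≤ j ∧ j ≤ k ∧ w[j]? = some a ∧ ∀ n, l ≤ n → n < j → w[n]? ≠ some a := by
  classical
  have hex : ∃ j, l ≤ j ∧ w[j]? = some a := ⟨k, hl, hk⟩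
  exact ⟨Nat.find hex, (Nat.find_spec hex).1, Nat.find_min' hex ⟨hl, hk⟩, (Nat.find_spec hex).2,
    fun n hn hlt h => Nat.find_min hex hlt ⟨hn, h⟩⟩

theorem exists_last_letter {w : List σ} {a : σ} {k u : ℕ} (hu : k < u) (hk : w[k]? = some a) :
    ∃ j, k ≤ j ∧ j < u ∧ w[j]? = some a ∧ ∀ n, j < n → n < u → w[n]? ≠ some a := by
  classical
  let q : ℕ → Prop := fun j => j < u ∧ w[j]? = some a
  have hq : q k := ⟨hu, hk⟩
  have hs := Nat.findGreatest_spec (P := q) hu.le hq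
  refine ⟨Nat.findGreatest q u, Nat.le_findGreatest hu.le hq, hs.1, hs.2, fun n hn hlt h => ?_⟩
  exact absurd (Nat.le_findGreatest (P := q) hlt.le ⟨hlt, h⟩) (by omega)

/-! ### Semantics of the derived connectives and of the end markers. -/

namespace TLXY

@[simp] theorem sat_letter {w : List σ} {i : ℕ} {a : σ} :
    Sat w i (letter a) ↔ w[i]? = some a := Iff.rfl

@[simp] theorem sat_top {w : List σ} {i : ℕ} : Sat w i top := trivial

@[simp] theorem sat_bot {w : List σ} {i : ℕ} : ¬ Sat w i bot := fun h => h trivial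

@[simp] theorem sat_mod {w : List σ} {i : ℕ} {m : Modality σ} {φ : TLXY σ} :
    Sat w i (mod m φ) ↔ ∃ j, m.Step w i j ∧ Sat w j φ := Iff.rfl

@[simp] theorem sat_or {w : List σ} {i : ℕ} {φ ψ : TLXY σ} :
    Sat w i (or φ ψ) ↔ Sat w i φ ∨ Sat w i ψ := Iff.rfl

@[simp] theorem sat_not {w : List σ} {i : ℕ} {φ : TLXY σ} :
    Sat w i (not φ) ↔ ¬ Sat w i φ := Iff.rfl

@[simp] theorem sat_and {w : List σ} {i : ℕ} {φ ψ : TLXY σ} :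
    Sat w i (and φ ψ) ↔ Sat w i φ ∧ Sat w i ψ := by
  simp only [and, sat_not, sat_or]; tauto

@[simp] theorem sat_bigAnd {ι : Type*} {s : Finset ι} {f : ι → TLXY σ} {w : List σ} {i : ℕ} :
    Sat w i (bigAnd s f) ↔ ∀ x ∈ s, Sat w i (f x) := by
  have key : ∀ l : List ι, Sat w i ((l.map f).foldr and top) ↔ ∀ x ∈ l, Sat w i (f x) := by
    intro l
    induction l with
    | nil => simp
    | cons a l ih => simp [ih]
  exact (key s.toList).trans (by simp only [Finset.mem_toList])

@[simp] theorem sat_bigOr {ι : Type*} {s : Finset ι} {f : ι → TLXY σ} {w : List σ} {i : ℕ} :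
    Sat w i (bigOr s f) ↔ ∃ x ∈ s, Sat w i (f x) := by
  have key : ∀ l : List ι, Sat w i ((l.map f).foldr or bot) ↔ ∃ x ∈ l, Sat w i (f x) := by
    intro l
    induction l with
    | nil => simp
    | cons a l ih => simp [ih]
  exact (key s.toList).trans (by simp only [Finset.mem_toList])

theorem sat_atFirst [Fintype σ] {w : List σ} {i : ℕ} (hi : i < w.length) :
    Sat w i atFirst ↔ i = 0 := by
  simp only [atFirst, sat_not, sat_bigOr, sat_mod, sat_top, Finset.mem_univ, true_and, and_true]
  constructor
  · intro h
    by_contra h0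
    have h1 : i - 1 < w.length := by omega
    obtain ⟨j, -, hj⟩ := exists_last_letter (u := i) (k := i - 1) (by omega)
      (List.getElem?_eq_getElem h1)
    exact h ⟨_, j, hj⟩
  · rintro rfl ⟨a, j, hj⟩
    exact absurd hj.1 (Nat.not_lt_zero _)

theorem sat_atLast [Fintype σ] {w : List σ} {i : ℕ} (hi : i < w.length) :
    Sat w i atLast ↔ i + 1 = w.length := by
  simp only [atLast, sat_not, sat_bigOr, sat_mod, sat_top, Finset.mem_univ, true_and, and_true]
  constructor
  · intro h
    by_contra h0
    have h1 : i + 1 < w.length := by omega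
    obtain ⟨j, hj, -, hj'⟩ := exists_first_letter (l := i + 1) le_rfl
      (List.getElem?_eq_getElem h1)
    exact h ⟨_, j, hj, hj'⟩
  · rintro h ⟨a, j, hj⟩
    have h1 := hj.lt_length
    have h2 := hj.1
    omega

end TLXY

/-! ### Runs of rankers and correctness of the directionality formulas. -/

namespace Ranker

open TLXY

theorem Run.unique {w : List σ} {r : Ranker σ} {i j k : ℕ} (hj : Run w r i j)
    (hk : Run w r i k) : j = k := by
  induction r generalizing i with
  | nil => exact Eq.trans (Eq.symm hj) hk
  | cons m r ih =>
    obtain ⟨x, hx, hj⟩ := hj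
    obtain ⟨y, hy, hk⟩ := hk
    obtain rfl := hx.unique hy
    exact ih hj hk

theorem run_append {w : List σ} {r s : Ranker σ} {i j : ℕ} :
    Run w (r ++ s) i j ↔ ∃ k, Run w r i k ∧ Run w s k j := by
  induction r generalizing i with
  | nil => simp [Run]
  | cons m r ih =>
    simp only [List.cons_append, Run, ih]
    constructor
    · rintro ⟨x, hx, k, h⟩
      exact ⟨k, ⟨x, hx, h.1⟩, h.2⟩
    · rintro ⟨k, ⟨x, hx, h⟩, h'⟩
      exact ⟨x, hx, k, h, h'⟩

@[simp] theorem run_singleton {w : List σ} {m : Modality σ} {i j : ℕ} :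
    Run w [m] i j ↔ m.Step w i j := by
  simp [Run]

theorem Run.lt_length {w : List σ} {r : Ranker σ} {i j : ℕ} (h : Run w r i j)
    (hi : i < w.length) : j < w.length := by
  induction r generalizing i with
  | nil => obtain rfl : i = j := h; exact hi
  | cons m r ih =>
    obtain ⟨k, hk, h⟩ := h
    exact ih h hk.lt_length

theorem not_run_u {w : List σ} {i j : ℕ} : ¬ Run w u i j := by
  rintro ⟨k, hk, l, hl, -⟩
  have h1 := hk.1
  have h2 := hl.1
  omega

theorem sat_comp {w : List σ} {r : Ranker σ} {φ : TLXY σ} {i : ℕ} :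
    Sat w i (r.comp φ) ↔ ∃ j, Run w r i j ∧ Sat w j φ := by
  induction r generalizing i with
  | nil => simp [comp, Run]
  | cons m r ih =>
    change (∃ k, m.Step w i k ∧ Sat w k (comp r φ)) ↔ _
    simp only [ih, Run]
    constructor
    · rintro ⟨k, hk, j, h, h'⟩
      exact ⟨j, ⟨k, hk, h⟩, h'⟩
    · rintro ⟨j, ⟨k, hk, h⟩, h'⟩
      exact ⟨k, hk, j, h, h'⟩

theorem Run.sat_comp_iff {w : List σ} {r : Ranker σ} {φ : TLXY σ} {i j : ℕ} (h : Run w r i j) :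
    Sat w i (r.comp φ) ↔ Sat w j φ :=
  sat_comp.trans ⟨fun ⟨_, hk, h'⟩ => h.unique hk ▸ h', fun h' => ⟨j, h, h'⟩⟩

theorem sat_toTLXY {w : List σ} {r : Ranker σ} {i : ℕ} :
    Sat w i r.toTLXY ↔ ∃ j, Run w r i j := by
  simp [toTLXY, sat_comp]

/-- The directionality formulas `d` compare positions of `w` with `p`. -/
def Directionality.Correct (d : Directionality σ) (w : List σ) (p : ℕ) : Prop :=
  ∀ i < w.length, (Sat w i d.lt ↔ i < p) ∧ (Sat w i d.le ↔ i ≤ p) ∧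
    (Sat w i d.gt ↔ p < i) ∧ (Sat w i d.ge ↔ p ≤ i)

/-- Common core of `X a` and `WX a`, which differ only in the bound `lo` where the search starts. No
`a` lies in `[lo, p)`. So `i ≤ p` iff the nearest `a` before `i` is missing or lies before `lo`, and
`p < i` iff it exists and is at least `lo`. The other two formulas compare the nearest `a` after `i`
with `p` in the same way. -/
theorem correct_of_first {w : List σ} {a : σ} {lo p : ℕ} {lt ge : TLXY σ}
    (hlt : ∀ i < w.length, (Sat w i lt ↔ i < lo)) (hge : ∀ i < w.length, (Sat w i ge ↔ lo ≤ i))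
    (hlo : lo ≤ p) (hp : w[p]? = some a) (hfirst : ∀ k, lo ≤ k → k < p → w[k]? ≠ some a) :
    Directionality.Correct
      ⟨mod (.X a) (or (not (mod (.Y a) top)) (mod (.Y a) lt)),
        or (not (mod (.Y a) top)) (mod (.Y a) lt), mod (.Y a) ge,
        or (not (mod (.X a) top)) (mod (.X a) (mod (.Y a) ge))⟩ w p := by
  have hle : ∀ i < w.length, (Sat w i (or (not (mod (.Y a) top)) (mod (.Y a) lt)) ↔ i ≤ p) := by
    intro i hi
    simp only [sat_or, sat_not, sat_mod, sat_top, and_true]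
    constructor
    · intro h
      by_contra hc
      obtain ⟨j, hj⟩ := exists_last_letter (u := i) (not_le.1 hc) hp
      have hs : Modality.Step w (.Y a) i j := ⟨hj.2.1, hj.2.2.1, hj.2.2.2⟩
      rcases h with h | ⟨j', hj', h⟩
      · exact h ⟨j, hs⟩
      · obtain rfl := hs.unique hj'
        have := (hlt _ hs.lt_length).1 h
        omega
    · intro h
      by_cases hex : ∃ j, Modality.Step w (.Y a) i j
      · obtain ⟨j, hj⟩ := hex
        refine Or.inr ⟨j, hj, (hlt _ hj.lt_length).2 ?_⟩
        by_contra hc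
        exact hfirst j (not_lt.1 hc) (lt_of_lt_of_le hj.1 h) hj.2.1
      · exact Or.inl hex
  have hgt : ∀ i < w.length, (Sat w i (mod (.Y a) ge) ↔ p < i) := by
    intro i hi
    simp only [sat_mod]
    constructor
    · rintro ⟨j, hj, h⟩
      have h1 := (hge _ hj.lt_length).1 h
      by_contra hc
      exact hfirst j h1 (lt_of_lt_of_le hj.1 (not_lt.1 hc)) hj.2.1
    · intro h
      obtain ⟨j, hj⟩ := exists_last_letter (u := i) h hp
      have hs : Modality.Step w (.Y a) i j := ⟨hj.2.1, hj.2.2.1, hj.2.2.2⟩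
      exact ⟨j, hs, (hge _ hs.lt_length).2 (by omega)⟩
  intro i hi
  refine ⟨?_, hle i hi, hgt i hi, ?_⟩
  · rw [sat_mod]
    constructor
    · rintro ⟨j, hj, h⟩
      exact lt_of_lt_of_le hj.1 ((hle _ hj.lt_length).1 h)
    · intro h
      obtain ⟨j, hj⟩ := exists_first_letter (l := i + 1) h hp
      have hs : Modality.Step w (.X a) i j := ⟨hj.1, hj.2.2.1, fun k hk => hj.2.2.2 k hk⟩
      exact ⟨j, hs, (hle _ hs.lt_length).2 hj.2.1⟩
  · rw [sat_or, sat_not, sat_mod, sat_mod]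
    simp only [sat_top, and_true]
    constructor
    · intro h
      by_contra hc
      obtain ⟨j, hj⟩ := exists_first_letter (l := i + 1) (not_le.1 hc) hp
      have hs : Modality.Step w (.X a) i j := ⟨hj.1, hj.2.2.1, fun k hk => hj.2.2.2 k hk⟩
      rcases h with h | ⟨j', hj', h⟩
      · exact h ⟨j, hs⟩
      · obtain rfl := hs.unique hj'
        have := (hgt _ hs.lt_length).1 h
        omega
    · intro h
      by_cases hex : ∃ j, Modality.Step w (.X a) i j
      · obtain ⟨j, hj⟩ := hex
        exact Or.inr ⟨j, hj, (hgt _ hj.lt_length).2 (lt_of_le_of_lt h hj.1)⟩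
      · exact Or.inl hex

/-- Mirror image for `Y a` and `WY a`, with an exclusive upper bound `hi` on the search. -/
theorem correct_of_last {w : List σ} {a : σ} {hi p : ℕ} {le gt : TLXY σ}
    (hle : ∀ i < w.length, (Sat w i le ↔ i < hi)) (hgt : ∀ i < w.length, (Sat w i gt ↔ hi ≤ i))
    (hlo : p < hi) (hp : w[p]? = some a) (hlast : ∀ k, p < k → k < hi → w[k]? ≠ some a) :
    Directionality.Correct
      ⟨mod (.X a) le, or (not (mod (.Y a) top)) (mod (.Y a) (mod (.X a) le)),
        mod (.Y a) (or (not (mod (.X a) top)) (mod (.X a) gt)),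
        or (not (mod (.X a) top)) (mod (.X a) gt)⟩ w p := by
  have hge : ∀ i < w.length, (Sat w i (or (not (mod (.X a) top)) (mod (.X a) gt)) ↔ p ≤ i) := by
    intro i hi
    simp only [sat_or, sat_not, sat_mod, sat_top, and_true]
    constructor
    · intro h
      by_contra hc
      obtain ⟨j, hj⟩ := exists_first_letter (l := i + 1) (not_le.1 hc) hp
      have hs : Modality.Step w (.X a) i j := ⟨hj.1, hj.2.2.1, fun k hk => hj.2.2.2 k hk⟩
      rcases h with h | ⟨j', hj', h⟩
      · exact h ⟨j, hs⟩
      · obtain rfl := hs.unique hj'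
        have := (hgt _ hs.lt_length).1 h
        omega
    · intro h
      by_cases hex : ∃ j, Modality.Step w (.X a) i j
      · obtain ⟨j, hj⟩ := hex
        refine Or.inr ⟨j, hj, (hgt _ hj.lt_length).2 ?_⟩
        by_contra hc
        exact hlast j (lt_of_le_of_lt h hj.1) (not_le.1 hc) hj.2.1
      · exact Or.inl hex
  have hlt : ∀ i < w.length, (Sat w i (mod (.X a) le) ↔ i < p) := by
    intro i hi
    simp only [sat_mod]
    constructor
    · rintro ⟨j, hj, h⟩
      have h1 := (hle _ hj.lt_length).1 h
      by_contra hc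
      exact hlast j (lt_of_le_of_lt (not_lt.1 hc) hj.1) h1 hj.2.1
    · intro h
      obtain ⟨j, hj⟩ := exists_first_letter (l := i + 1) h hp
      have hs : Modality.Step w (.X a) i j := ⟨hj.1, hj.2.2.1, fun k hk => hj.2.2.2 k hk⟩
      exact ⟨j, hs, (hle _ hs.lt_length).2 (by omega)⟩
  intro i hi
  refine ⟨hlt i hi, ?_, ?_, hge i hi⟩
  · rw [sat_or, sat_not, sat_mod, sat_mod]
    simp only [sat_top, and_true]
    constructor
    · intro h
      by_contra hc
      obtain ⟨j, hj⟩ := exists_last_letter (u := i) (not_le.1 hc) hp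
      have hs : Modality.Step w (.Y a) i j := ⟨hj.2.1, hj.2.2.1, hj.2.2.2⟩
      rcases h with h | ⟨j', hj', h⟩
      · exact h ⟨j, hs⟩
      · obtain rfl := hs.unique hj'
        have := (hlt _ hs.lt_length).1 h
        omega
    · intro h
      by_cases hex : ∃ j, Modality.Step w (.Y a) i j
      · obtain ⟨j, hj⟩ := hex
        exact Or.inr ⟨j, hj, (hlt _ hj.lt_length).2 (lt_of_lt_of_le hj.1 h)⟩
      · exact Or.inl hex
  · rw [sat_mod]
    constructor
    · rintro ⟨j, hj, h⟩
      exact lt_of_le_of_lt ((hge _ hj.lt_length).1 h) hj.1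
    · intro h
      obtain ⟨j, hj⟩ := exists_last_letter (u := i) h hp
      have hs : Modality.Step w (.Y a) i j := ⟨hj.2.1, hj.2.2.1, hj.2.2.2⟩
      exact ⟨j, hs, (hge _ hs.lt_length).2 hj.1⟩

variable [Fintype σ]

theorem correct_first {w : List σ} :
    Directionality.Correct ⟨bot, atFirst, not atFirst, top⟩ w 0 := by
  intro i hi
  simp only [sat_not, sat_atFirst hi, sat_top, sat_bot, true_iff, false_iff]
  omega

/-- On a word where the reversed ranker `s` accepts, `dirRev s` describes its accepting position. -/
theorem dirRev_correct {w : List σ} (s : Ranker σ) {p : ℕ} (h : Run w s.reverse 0 p) :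
    (dirRev s).Correct w p := by
  induction s generalizing p with
  | nil =>
    obtain rfl : 0 = p := h
    exact correct_first
  | cons m s ih =>
    rw [List.reverse_cons, run_append] at h
    obtain ⟨q, hq, h⟩ := h
    rw [run_singleton] at h
    have hd := ih hq
    cases m with
    | SP =>
      obtain ⟨rfl, -⟩ := h
      exact correct_first
    | EP =>
      intro i hi
      simp only [Modality.Step] at h
      simp only [dirRev, sat_not, sat_atLast hi, sat_top, sat_bot, true_iff, false_iff]
      omega
    | X a =>
      -- The strict search starts at `q + 1`, so the prefix's `≤ q` and `> q` serve as `< lo` and `≥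
      -- lo`. The weak search below starts at `q` itself.
      exact correct_of_first (lo := q + 1)
        (fun i hi => (hd i hi).2.1.trans Nat.lt_succ_iff.symm)
        (fun i hi => (hd i hi).2.2.1) h.1 h.2.1 h.2.2
    | WX a =>
      exact correct_of_first (fun i hi => (hd i hi).1) (fun i hi => (hd i hi).2.2.2) h.1 h.2.1 h.2.2
    | Y a =>
      exact correct_of_last (fun i hi => (hd i hi).1) (fun i hi => (hd i hi).2.2.2) h.1 h.2.1 h.2.2
    | WY a =>
      exact correct_of_last (hi := q + 1)
        (fun i hi => (hd i hi).2.1.trans Nat.lt_succ_iff.symm)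
        (fun i hi => (hd i hi).2.2.1) (Nat.lt_succ_of_le h.1) h.2.1
        (fun k hk hk' => h.2.2 k hk (Nat.le_of_lt_succ hk'))
    | X1 =>
      obtain ⟨rfl, hp⟩ := h
      intro i hi
      have key : ∀ φ : TLXY σ, Sat w i (mod .Y1 φ) ↔ 0 < i ∧ Sat w (i - 1) φ := by
        intro φ
        constructor
        · rintro ⟨j, ⟨hj, -⟩, h⟩
          obtain rfl : j = i - 1 := by omega
          exact ⟨by omega, h⟩
        · rintro ⟨h0, h⟩
          exact ⟨i - 1, ⟨by omega, by omega⟩, h⟩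
      -- For `i = 0` the truncated `i - 1` is still a position; `key` guards its use by `0 < i`.
      have hd' := hd (i - 1) (by omega)
      simp only [dirRev, sat_or, sat_atFirst hi, key, hd i hi, hd']
      omega
    | Y1 =>
      obtain ⟨rfl, hp⟩ := h
      intro i hi
      have key : ∀ φ : TLXY σ, Sat w i (mod .X1 φ) ↔ i + 1 < w.length ∧ Sat w (i + 1) φ := by
        intro φ
        constructor
        · rintro ⟨j, ⟨rfl, hj⟩, h⟩
          exact ⟨hj, h⟩
        · rintro ⟨h0, h⟩
          exact ⟨i + 1, ⟨rfl, h0⟩, h⟩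
      have hq' : p + 1 < w.length := hq.lt_length (by omega)
      -- At the last position `X1` leads nowhere, but that position is beyond `p` because `p + 1` is
      -- a position too.
      by_cases hi' : i + 1 < w.length
      · have hd' := hd (i + 1) hi'
        simp only [dirRev, sat_or, sat_atLast hi, key, hd i hi, hd']
        omega
      · simp only [dirRev, sat_or, sat_atLast hi, key, hd i hi, hi', false_and, or_false, false_iff]
        omega

theorem Run.directionality {w : List σ} {r : Ranker σ} {p : ℕ} (h : Run w r 0 p) :
    (dirRev r.reverse).Correct w p :=
  dirRev_correct _ (by rwa [List.reverse_reverse])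

theorem Run.sat_before {w : List σ} {r : Ranker σ} {i p : ℕ} (h : Run w r 0 p)
    (hi : i < w.length) : Sat w i r.before ↔ i < p := (h.directionality i hi).1

theorem Run.sat_upTo {w : List σ} {r : Ranker σ} {i p : ℕ} (h : Run w r 0 p)
    (hi : i < w.length) : Sat w i r.upTo ↔ i ≤ p := (h.directionality i hi).2.1

theorem Run.sat_after {w : List σ} {r : Ranker σ} {i p : ℕ} (h : Run w r 0 p)
    (hi : i < w.length) : Sat w i r.after ↔ p < i := (h.directionality i hi).2.2.1

end Ranker

/-! ### Uniqueness of defining positions. -/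

namespace TLFP

variable {σ : Type*}

theorem IsDPos.lt_length {w : List σ} {ψ : TLFP σ} {i : ℕ} (h : IsDPos w ψ i) : i < w.length := by
  cases ψ with
  | F φ => exact h.1
  | P φ => exact h.1
  | letter a => exact h.elim
  | or φ₁ φ₂ => exact h.elim
  | not φ => exact h.elim

theorem IsDPos.sat {w : List σ} {ψ : TLFP σ} {i : ℕ} (h : IsDPos w ψ i) : Sat w i ψ := by
  cases ψ with
  | F φ => exact h.2.1
  | P φ => exact h.2.1
  | letter a => exact h.elim
  | or φ₁ φ₂ => exact h.elim
  | not φ => exact h.elim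

theorem IsDPos.defined {w : List σ} {ψ : TLFP σ} {i : ℕ} (h : IsDPos w ψ i) : Defined w ψ :=
  ⟨i, h.lt_length, h.sat⟩

theorem IsDPos.unique {w : List σ} {ψ : TLFP σ} {i j : ℕ} (hi : IsDPos w ψ i)
    (hj : IsDPos w ψ j) : i = j := by
  cases ψ with
  | F φ =>
    rcases lt_trichotomy i j with h | h | h
    · exact absurd hj.2.1 (hi.2.2 _ h hj.1)
    · exact h
    · exact absurd hi.2.1 (hj.2.2 _ h hi.1)
  | P φ =>
    rcases lt_trichotomy i j with h | h | h
    · exact absurd hi.2.1 (hj.2.2 _ h)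
    · exact h
    · exact absurd hj.2.1 (hi.2.2 _ h)
  | letter a => exact hi.elim
  | or φ₁ φ₂ => exact hi.elim
  | not φ => exact hi.elim

end TLFP

/-! ### Cuts of a word and the meaning of the validity formulas for one template. -/

namespace RegionTemplate

open TLXY Ranker

variable {σ : Type*} {κ : Finset (TLFP σ)} {R : RegionTemplate κ} {D : κ → Ranker σ}
  {w : List σ} {c : ℕ → ℕ}

/-- Consecutive intervals of `w`, one for each region, with the F-regions at their defining
positions. -/
structure IsCut (R : RegionTemplate κ) (w : List σ) (c : ℕ → ℕ) : Prop where
  zero : c 0 = 0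
  last : c R.m = w.length
  le_succ : ∀ i : Fin R.m, c i ≤ c (i + 1)
  isDPos : ∀ i : Fin R.m, (R.τ i).Nonempty →
    c (i + 1) = c i + 1 ∧ ∀ ζ ∈ R.τ i, TLFP.IsDPos w ζ.1 (c i)

/-- In the interval `[l, u)` of `w` the first `a` is to the left of all `b`. -/
def LeftBefore (w : List σ) (l u : ℕ) (a b : σ) : Prop :=
  ∃ k, l ≤ k ∧ k < u ∧ w[k]? = some a ∧ ∀ n, l ≤ n → n ≤ k → w[n]? ≠ some b

/-- In the interval `[l, u)` of `w` the last `a` is to the right of all `b`. -/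
def RightBefore (w : List σ) (l u : ℕ) (a b : σ) : Prop :=
  ∃ k, l ≤ k ∧ k < u ∧ w[k]? = some a ∧ ∀ n, k ≤ n → n < u → w[n]? ≠ some b

/-- The sets `alpha` are the letters that occur in the intervals. -/
def IsAlphabet (R : RegionTemplate κ) (w : List σ) (c : ℕ → ℕ) : Prop :=
  ∀ (i : Fin R.m) (a : σ), a ∈ R.alpha i ↔ ∃ k, c i ≤ k ∧ k < c (i + 1) ∧ w[k]? = some a

theorem isTemplateOf_iff : R.IsTemplateOf w ↔ ∃ c, IsCut R w c ∧ IsAlphabet R w c ∧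
    (∀ i : Fin R.m, (R.left i).Pairwise (LeftBefore w (c i) (c (i + 1)))) ∧
    ∀ i : Fin R.m, (R.right i).Pairwise (RightBefore w (c i) (c (i + 1))) :=
  ⟨fun ⟨c, h1, h2, h3, h4, h5, h6⟩ => ⟨c, ⟨h1, h2, h3, h4⟩, h5, h6⟩,
    fun ⟨c, ⟨h1, h2, h3, h4⟩, h5, h6⟩ => ⟨c, h1, h2, h3, h4, h5, h6⟩⟩

theorem IsCut.mono (hc : IsCut R w c) {i j : ℕ} (hij : i ≤ j) (hj : j ≤ R.m) : c i ≤ c j := by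
  induction j, hij using Nat.le_induction with
  | base => exact le_rfl
  | succ n hn ih => exact (ih (by omega)).trans (hc.le_succ ⟨n, hj⟩)

/-- The rankers `D ζ` accept exactly at the defining positions of the formulas `ζ`. -/
def Locates (D : κ → Ranker σ) (w : List σ) : Prop :=
  ∀ ζ j, Run w (D ζ) 0 j ↔ TLFP.IsDPos w ζ.1 j

theorem regRanker_spec {i : Fin R.m} (hi : (R.τ i).Nonempty) :
    ∃ ζ ∈ R.τ i, R.regRanker D i = D ζ :=
  ⟨hi.choose, hi.choose_spec, by rw [regRanker, dif_pos hi]⟩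

theorem IsCut.run (hc : IsCut R w c) (hD : Locates D w) {i : Fin R.m} {ζ : κ} (hζ : ζ ∈ R.τ i) :
    Run w (D ζ) 0 (c i) :=
  (hD _ _).2 ((hc.isDPos i ⟨ζ, hζ⟩).2 ζ hζ)

theorem IsCut.run_regRanker (hc : IsCut R w c) (hD : Locates D w) {i : Fin R.m}
    (hi : (R.τ i).Nonempty) : Run w (R.regRanker D i) 0 (c i) := by
  obtain ⟨ζ, hζ, h⟩ := regRanker_spec (D := D) hi
  exact h ▸ hc.run hD hζ

theorem nonempty_pred {i : Fin R.m} (hi : ¬ (R.τ i).Nonempty) (h0 : i.val ≠ 0) :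
    (R.τ ⟨i.val - 1, lt_of_le_of_lt (Nat.sub_le _ _) i.2⟩).Nonempty :=
  (R.alternate _ i (by simp only; omega)).2 hi

theorem nonempty_succ {i : Fin R.m} (hi : ¬ (R.τ i).Nonempty) (h : i.val + 1 < R.m) :
    (R.τ ⟨i.val + 1, h⟩).Nonempty := by
  by_contra hc
  exact hi ((R.alternate i ⟨i.val + 1, h⟩ rfl).2 hc)

/-- Transitivity is what lets `bvalid` test only consecutive letters of an order. -/
theorem LeftBefore.trans {l u : ℕ} {a b d : σ} (h : LeftBefore w l u a b)
    (h' : LeftBefore w l u b d) : LeftBefore w l u a d := by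
  obtain ⟨k, h1, h2, h3, h4⟩ := h
  obtain ⟨k', g1, g2, g3, g4⟩ := h'
  have : k < k' := by
    by_contra hn
    exact h4 k' g1 (not_lt.1 hn) g3
  exact ⟨k, h1, h2, h3, fun n hn hn' => g4 n hn (by omega)⟩

theorem RightBefore.trans {l u : ℕ} {a b d : σ} (h : RightBefore w l u a b)
    (h' : RightBefore w l u b d) : RightBefore w l u a d := by
  obtain ⟨k, h1, h2, h3, h4⟩ := h
  obtain ⟨k', g1, g2, g3, g4⟩ := h'
  have : k' < k := by
    by_contra hn
    exact h4 k' (not_lt.1 hn) g2 g3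
  exact ⟨k, h1, h2, h3, fun n hn hn' => g4 n (by omega) hn'⟩

/-- Covers the F-regions: with a single letter there is nothing to order, and `bvalid` tests nothing
there. -/
theorem pairwise_of_card_eq_one {s : Finset σ} (hs : s.card = 1) {l : List σ} (hl : l.Nodup)
    (hmem : ∀ a, a ∈ l ↔ a ∈ s) (r : σ → σ → Prop) : l.Pairwise r := by
  obtain ⟨x, rfl⟩ := Finset.card_eq_one.1 hs
  rcases l with _ | ⟨a, _ | ⟨b, l⟩⟩
  · exact List.Pairwise.nil
  · exact List.pairwise_singleton _ _
  · have ha := (hmem a).1 (by simp)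
    have hb := (hmem b).1 (by simp)
    simp only [Finset.mem_singleton] at ha hb
    simp [ha, hb] at hl

theorem not_nonempty_succ {i : Fin R.m} (hi : (R.τ i).Nonempty) (h : i.val + 1 < R.m) :
    ¬ (R.τ ⟨i.val + 1, h⟩).Nonempty :=
  (R.alternate i ⟨i.val + 1, h⟩ rfl).1 hi

theorem nonempty_succ_succ {i : Fin R.m} (hi : (R.τ i).Nonempty) (h : i.val + 2 < R.m) :
    (R.τ ⟨i.val + 2, h⟩).Nonempty :=
  nonempty_succ (i := ⟨i.val + 1, by omega⟩) (not_nonempty_succ hi (by omega)) h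

/-- The preceding F-region is the single position `c i - 1`, so a strict search from it begins at `c
i`; region `0` needs the weak search from the first position. The search has no right bound and may
leave the region. -/
theorem IsCut.run_fromLeft (hc : IsCut R w c) (hD : Locates D w) (hw : w ≠ []) {i : Fin R.m}
    (hi : ¬ (R.τ i).Nonempty) {b : σ} {j : ℕ} :
    Run w (R.fromLeft D i b) 0 j ↔
      c i ≤ j ∧ w[j]? = some b ∧ ∀ k, c i ≤ k → k < j → w[k]? ≠ some b := by
  have hw' := List.length_pos_iff.2 hw
  by_cases h0 : i.val = 0
  · rw [fromLeft, if_pos h0, h0, hc.zero]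
    simp [Run, Modality.Step, hw']
  · have hp := nonempty_pred hi h0
    have hr := hc.run_regRanker hD hp
    have hs := (hc.isDPos _ hp).1
    have hi1 : i.val - 1 + 1 = i.val := by omega
    simp only [hi1] at hs
    rw [fromLeft, if_neg h0, run_append]
    simp only [run_singleton]
    constructor
    · rintro ⟨k, hk, h⟩
      obtain rfl := hr.unique hk
      rw [hs]
      exact h
    · intro h
      rw [hs] at h
      exact ⟨_, hr, h⟩

/-- The following F-region sits at `c (i + 1)`, which the strict search excludes. After the last
region `c (i + 1)` is the length of the word, so the search is weak and starts one position earlier.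
-/
theorem IsCut.run_fromRight (hc : IsCut R w c) (hD : Locates D w) (hw : w ≠ []) {i : Fin R.m}
    (hi : ¬ (R.τ i).Nonempty) {b : σ} {j : ℕ} :
    Run w (R.fromRight D i b) 0 j ↔
      j < c (i + 1) ∧ w[j]? = some b ∧ ∀ k, j < k → k < c (i + 1) → w[k]? ≠ some b := by
  have hw' := List.length_pos_iff.2 hw
  by_cases h : i.val + 1 < R.m
  · have hp := nonempty_succ hi h
    have hr := hc.run_regRanker hD hp
    rw [fromRight, dif_pos h, run_append]
    simp only [run_singleton]
    exact ⟨fun ⟨k, hk, h⟩ => hr.unique hk ▸ h, fun h => ⟨_, hr, h⟩⟩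
  · have hm : i.val + 1 = R.m := by have := i.2; omega
    rw [fromRight, dif_neg h, hm, hc.last]
    simp only [Run, Modality.Step]
    constructor
    · rintro ⟨k, hk, l, ⟨hl, h1, h2⟩, rfl⟩
      exact ⟨by omega, h1, fun n hn hn' => h2 n hn (by omega)⟩
    · rintro ⟨h1, h2, h3⟩
      exact ⟨w.length - 1, by omega, j, ⟨by omega, h2, fun k hk hk' => h3 k hk (by omega)⟩, rfl⟩

section Checks

variable [Fintype σ]

/-- In an I-region the first `a` after the left border decides: `a` occurs in the region iff this
position precedes the next F-region, which the directionality test checks. -/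
theorem IsCut.sat_occurs (hc : IsCut R w c) (hD : Locates D w) (hw : w ≠ []) {i : Fin R.m}
    {a : σ} : Sat w 0 (R.occurs D i a) ↔ ∃ k, c i ≤ k ∧ k < c (i + 1) ∧ w[k]? = some a := by
  by_cases hi : (R.τ i).Nonempty
  · rw [occurs, if_pos hi, (hc.run_regRanker hD hi).sat_comp_iff, (hc.isDPos i hi).1, sat_letter]
    constructor
    · intro h
      exact ⟨c i, le_rfl, Nat.lt_succ_self _, h⟩
    · rintro ⟨k, h1, h2, h⟩
      obtain rfl : k = c i := by omega
      exact h
  · have hb : ∀ j < w.length, (Sat w j (if h : i.val + 1 < R.m then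
        before (R.regRanker D ⟨i.val + 1, h⟩) else top) ↔ j < c (i + 1)) := by
      intro j hj
      split_ifs with h
      · exact (hc.run_regRanker hD (nonempty_succ hi h)).sat_before hj
      · have hm : i.val + 1 = R.m := by have := i.2; omega
        rw [hm, hc.last]
        simpa using hj
    rw [occurs, if_neg hi, sat_comp]
    constructor
    · rintro ⟨j, hj, h⟩
      have hl := hj.lt_length (List.length_pos_iff.2 hw)
      rw [hc.run_fromLeft hD hw hi] at hj
      exact ⟨j, hj.1, (hb j hl).1 h, hj.2.1⟩
    · rintro ⟨k, h1, h2, h⟩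
      obtain ⟨j, hj, hjk, hja, hn⟩ := exists_first_letter h1 h
      exact ⟨j, (hc.run_fromLeft hD hw hi).2 ⟨hj, hja, hn⟩,
        (hb j (List.getElem?_eq_some_iff.1 hja).1).2 (lt_of_le_of_lt hjk h2)⟩

theorem IsCut.sat_avalid (hc : IsCut R w c) (hD : Locates D w) (hw : w ≠ []) :
    Sat w 0 (R.avalid D) ↔ IsAlphabet R w c := by
  simp only [avalid, sat_bigAnd, sat_and, sat_not, hc.sat_occurs hD hw, Finset.mem_univ,
    Finset.mem_sdiff, true_and, forall_const, IsAlphabet]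
  refine forall_congr' fun i => ⟨fun h a => ⟨h.1 a, fun ha => ?_⟩,
    fun h => ⟨fun a => (h a).1, fun a ha ha' => ha ((h a).2 ha')⟩⟩
  by_contra hn
  exact h.2 a hn ha

/-- Both letters must occur in the region: the directionality formula of a ranker is meaningful only
where the ranker accepts. -/
theorem IsCut.sat_leftBefore (hc : IsCut R w c) (hD : Locates D w) (hw : w ≠ [])
    (hα : IsAlphabet R w c) {i : Fin R.m} (hi : ¬ (R.τ i).Nonempty) {a b : σ}
    (ha : a ∈ R.alpha i) (hb : b ∈ R.alpha i) :
    Sat w 0 (comp (R.fromLeft D i a) (before (R.fromLeft D i b))) ↔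
      LeftBefore w (c i) (c (i + 1)) a b := by
  obtain ⟨k, h1, h2, h⟩ := (hα i a).1 ha
  obtain ⟨k', h1', h2', h'⟩ := (hα i b).1 hb
  obtain ⟨j, hj, hjk, hja, hn⟩ := exists_first_letter h1 h
  obtain ⟨j', hj', hjk', hjb, hn'⟩ := exists_first_letter h1' h'
  have hr := (hc.run_fromLeft hD hw hi).2 ⟨hj, hja, hn⟩
  have hr' := (hc.run_fromLeft hD hw hi).2 ⟨hj', hjb, hn'⟩
  rw [hr.sat_comp_iff, hr'.sat_before (List.getElem?_eq_some_iff.1 hja).1]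
  constructor
  · intro hlt
    exact ⟨j, hj, by omega, hja, fun n h3 h4 => hn' n h3 (by omega)⟩
  · rintro ⟨n, h3, h4, h5, h6⟩
    by_contra hge
    have h7 : j ≤ n := by
      by_contra h8
      exact hn n h3 (not_le.1 h8) h5
    exact h6 j' hj' (by omega) hjb

theorem IsCut.sat_rightBefore (hc : IsCut R w c) (hD : Locates D w) (hw : w ≠ [])
    (hα : IsAlphabet R w c) {i : Fin R.m} (hi : ¬ (R.τ i).Nonempty) {a b : σ}
    (ha : a ∈ R.alpha i) (hb : b ∈ R.alpha i) :
    Sat w 0 (comp (R.fromRight D i a) (after (R.fromRight D i b))) ↔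
      RightBefore w (c i) (c (i + 1)) a b := by
  obtain ⟨k, h1, h2, h⟩ := (hα i a).1 ha
  obtain ⟨k', h1', h2', h'⟩ := (hα i b).1 hb
  obtain ⟨j, hj, hjk, hja, hn⟩ := exists_last_letter h2 h
  obtain ⟨j', hj', hjk', hjb, hn'⟩ := exists_last_letter h2' h'
  have hr := (hc.run_fromRight hD hw hi).2 ⟨hjk, hja, hn⟩
  have hr' := (hc.run_fromRight hD hw hi).2 ⟨hjk', hjb, hn'⟩
  rw [hr.sat_comp_iff, hr'.sat_after (List.getElem?_eq_some_iff.1 hja).1]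
  constructor
  · intro hlt
    exact ⟨j, by omega, hjk, hja, fun n h3 h4 => hn' n (by omega) h4⟩
  · rintro ⟨n, h3, h4, h5, h6⟩
    by_contra hge
    have h7 : n ≤ j := by
      by_contra h8
      exact hn n (not_le.1 h8) h4 h5
    exact h6 j' (by omega) hjk' hjb

theorem IsCut.sat_lOrdChk (hc : IsCut R w c) (hD : Locates D w) (hw : w ≠ [])
    (hα : IsAlphabet R w c) {i : Fin R.m} (hi : ¬ (R.τ i).Nonempty) {l : List σ}
    (hl : ∀ a ∈ l, a ∈ R.alpha i) :
    Sat w 0 (R.lOrdChk D i l) ↔ l.Pairwise (LeftBefore w (c i) (c (i + 1))) := by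
  have : IsTrans σ (LeftBefore w (c i) (c (i + 1))) := ⟨fun _ _ _ => LeftBefore.trans⟩
  rw [← List.isChain_iff_pairwise]
  induction l with
  | nil => simp [lOrdChk]
  | cons a l ih =>
    cases l with
    | nil => simp [lOrdChk]
    | cons b l =>
      rw [lOrdChk, sat_and, hc.sat_leftBefore hD hw hα hi (hl a (by simp)) (hl b (by simp)),
        List.isChain_cons_cons]
      exact and_congr_right fun _ => ih fun x hx => hl x (List.mem_cons_of_mem _ hx)

theorem IsCut.sat_rOrdChk (hc : IsCut R w c) (hD : Locates D w) (hw : w ≠ [])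
    (hα : IsAlphabet R w c) {i : Fin R.m} (hi : ¬ (R.τ i).Nonempty) {l : List σ}
    (hl : ∀ a ∈ l, a ∈ R.alpha i) :
    Sat w 0 (R.rOrdChk D i l) ↔ l.Pairwise (RightBefore w (c i) (c (i + 1))) := by
  have : IsTrans σ (RightBefore w (c i) (c (i + 1))) := ⟨fun _ _ _ => RightBefore.trans⟩
  rw [← List.isChain_iff_pairwise]
  induction l with
  | nil => simp [rOrdChk]
  | cons a l ih =>
    cases l with
    | nil => simp [rOrdChk]
    | cons b l =>
      rw [rOrdChk, sat_and, hc.sat_rightBefore hD hw hα hi (hl a (by simp)) (hl b (by simp)),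
        List.isChain_cons_cons]
      exact and_congr_right fun _ => ih fun x hx => hl x (List.mem_cons_of_mem _ hx)

theorem IsCut.sat_bvalid (hc : IsCut R w c) (hD : Locates D w) (hw : w ≠ [])
    (hα : IsAlphabet R w c) : Sat w 0 (R.bvalid D) ↔
      (∀ i : Fin R.m, (R.left i).Pairwise (LeftBefore w (c i) (c (i + 1)))) ∧
        ∀ i : Fin R.m, (R.right i).Pairwise (RightBefore w (c i) (c (i + 1))) := by
  simp only [bvalid, sat_bigAnd, Finset.mem_univ, forall_const]
  rw [← forall_and]
  refine forall_congr' fun i => ?_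
  split_ifs with hi
  · simp only [sat_top, true_iff]
    exact ⟨pairwise_of_card_eq_one (R.alpha_card i hi) (R.left_nodup i) (R.mem_left i) _,
      pairwise_of_card_eq_one (R.alpha_card i hi) (R.right_nodup i) (R.mem_right i) _⟩
  · rw [sat_and, hc.sat_lOrdChk hD hw hα hi fun a => (R.mem_left i a).1,
      hc.sat_rOrdChk hD hw hα hi fun a => (R.mem_right i a).1]

theorem IsCut.sat_rvalid (hc : IsCut R w c) (hD : Locates D w) (hw : w ≠ []) :
    Sat w 0 (R.rvalid D) := by
  simp only [rvalid, sat_bigAnd, Finset.mem_univ, forall_const]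
  intro i
  split_ifs with hi
  · have hr := hc.run_regRanker hD hi
    have hl := hr.lt_length (List.length_pos_iff.2 hw)
    rw [sat_and]
    constructor
    · simp only [tauChk, sat_bigAnd, sat_and]
      intro ζ hζ ξ hξ
      have h1 := hc.run hD hζ
      have h2 := hc.run hD hξ
      rw [h1.sat_comp_iff, h2.sat_comp_iff, h1.sat_upTo hl, h2.sat_upTo hl]
      exact ⟨le_rfl, le_rfl⟩
    · rw [ordChk, sat_and, sat_and]
      refine ⟨?_, ?_, ?_⟩
      · split_ifs with h
        · rw [hr.sat_comp_iff, (hc.run_regRanker hD (nonempty_succ_succ hi h)).sat_before hl]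
          have h1 := (hc.isDPos i hi).1
          have h2 := hc.mono (i := i.val + 1) (j := i.val + 2) (by omega) (by omega)
          simp only
          omega
        · exact sat_top
      · split_ifs with h
        · rw [hr.sat_comp_iff, sat_atFirst hl, h, hc.zero]
        · exact sat_top
      · split_ifs with h
        · rw [hr.sat_comp_iff, sat_atLast hl, ← (hc.isDPos i hi).1, h, hc.last]
        · exact sat_top
  · exact sat_top

/-- The validity tests make all rankers of an F-region accept at one position and put these
positions in increasing order. They determine the borders of all the regions. -/
theorem exists_isCut_of_sat_rvalid (hD : Locates D w) (hw : w ≠ []) (h : Sat w 0 (R.rvalid D)) :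
    ∃ c, IsCut R w c := by
  classical
  have hw' := List.length_pos_iff.2 hw
  simp only [rvalid, sat_bigAnd, Finset.mem_univ, forall_const] at h
  have hpos : ∀ i : Fin R.m, ∃ p, (R.τ i).Nonempty → Run w (R.regRanker D i) 0 p ∧
      ∀ ζ ∈ R.τ i, Run w (D ζ) 0 p := by
    intro i
    by_cases hi : (R.τ i).Nonempty
    · have hi' := h i
      rw [if_pos hi, sat_and] at hi'
      have ht := hi'.1
      simp only [tauChk, sat_bigAnd, sat_and] at ht
      obtain ⟨ξ, hξ, hreg⟩ := regRanker_spec (D := D) hi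
      -- The diagonal instance is used only because it forces the ranker to accept.
      obtain ⟨p, hp, -⟩ := sat_comp.1 (ht ξ hξ ξ hξ).1
      refine ⟨p, fun _ => ⟨hreg ▸ hp, fun ζ hζ => ?_⟩⟩
      obtain ⟨q, hq, -⟩ := sat_comp.1 (ht ζ hζ ζ hζ).1
      have h1 := ht ξ hξ ζ hζ
      rw [hp.sat_comp_iff, hq.sat_comp_iff, hp.sat_upTo (hq.lt_length hw'),
        hq.sat_upTo (hp.lt_length hw')] at h1
      rwa [le_antisymm h1.1 h1.2]
    · exact ⟨0, fun hi' => absurd hi' hi⟩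
  choose p hp using hpos
  have hlt : ∀ i, (R.τ i).Nonempty → p i < w.length := fun i hi => (hp i hi).1.lt_length hw'
  have hord : ∀ i, (R.τ i).Nonempty →
      (∀ h : i.val + 2 < R.m, p i < p ⟨i.val + 2, h⟩) ∧ (i.val = 0 → p i = 0) ∧
        (i.val + 1 = R.m → p i + 1 = w.length) := by
    intro i hi
    have hi' := h i
    rw [if_pos hi, sat_and, ordChk, sat_and, sat_and] at hi'
    obtain ⟨-, h1, h2, h3⟩ := hi'
    refine ⟨fun h => ?_, fun h => ?_, fun h => ?_⟩
    · rwa [dif_pos h, (hp i hi).1.sat_comp_iff,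
        (hp _ (nonempty_succ_succ hi h)).1.sat_before (hlt i hi)] at h1
    · rwa [if_pos h, (hp i hi).1.sat_comp_iff, sat_atFirst (hlt i hi)] at h2
    · rwa [if_pos h, (hp i hi).1.sat_comp_iff, sat_atLast (hlt i hi)] at h3
  -- An F-region starts at its own position, an I-region just after the preceding F-region. The
  -- values at the two ends agree with this when an F-region is outermost, by the `atFirst` and
  -- `atLast` tests.
  let c : ℕ → ℕ := fun i =>
    if i = 0 then 0
    else if hm : i < R.m then
      if (R.τ ⟨i, hm⟩).Nonempty then p ⟨i, hm⟩ else p ⟨i - 1, by omega⟩ + 1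
    else w.length
  have hcF : ∀ i : Fin R.m, (R.τ i).Nonempty → c i = p i := by
    intro i hi
    by_cases h0 : i.val = 0
    · simp only [c, if_pos h0, (hord i hi).2.1 h0]
    · simp only [c, if_neg h0, dif_pos i.2, if_pos hi]
  have hcF' : ∀ i : Fin R.m, (R.τ i).Nonempty → c (i + 1) = p i + 1 := by
    intro i hi
    by_cases hm : i.val + 1 < R.m
    · simp only [c, dif_pos hm, if_neg (not_nonempty_succ hi hm)]
      simp
    · simp only [c, dif_neg hm]
      simp only [Nat.add_eq_zero_iff, one_ne_zero, and_false, if_false]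
      exact ((hord i hi).2.2 (by have := i.2; omega)).symm
  have hclast : c R.m = w.length := by
    simp [c, R.m_pos.ne']
  refine ⟨c, rfl, hclast, fun i => ?_, fun i hi => ?_⟩
  · by_cases hi : (R.τ i).Nonempty
    · rw [hcF i hi, hcF' i hi]; omega
    · by_cases h0 : i.val = 0
      · rw [h0]; exact Nat.zero_le _
      · have hpr := nonempty_pred hi h0
        have h1 := hcF' _ hpr
        have hi1 : i.val - 1 + 1 = i.val := by omega
        simp only [hi1] at h1
        rw [h1]
        by_cases hm : i.val + 1 < R.m
        · have h2 := hcF _ (nonempty_succ hi hm)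
          have h3 := (hord _ hpr).1 (by simp only; omega)
          have hi2 : i.val - 1 + 2 = i.val + 1 := by omega
          simp only [hi2] at h3
          simp only at h2
          omega
        · have hm' : i.val + 1 = R.m := by have := i.2; omega
          rw [hm', hclast]
          exact hlt _ hpr
  · refine ⟨by rw [hcF i hi, hcF' i hi], fun ζ hζ => ?_⟩
    rw [hcF i hi]
    exact (hD _ _).1 ((hp i hi).2 ζ hζ)

/-- `avalid` and then `bvalid` have the intended meaning relative to any cut, so uniqueness of the
cut is not needed: one direction uses the given cut, the other the cut built from `rvalid`. -/
theorem isTemplateOf_iff_sat (hD : Locates D w) (hw : w ≠ []) :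
    R.IsTemplateOf w ↔
      Sat w 0 (R.rvalid D) ∧ Sat w 0 (R.avalid D) ∧ Sat w 0 (R.bvalid D) := by
  rw [isTemplateOf_iff]
  constructor
  · rintro ⟨c, hc, hα, h⟩
    exact ⟨hc.sat_rvalid hD hw, (hc.sat_avalid hD hw).2 hα, (hc.sat_bvalid hD hw hα).2 h⟩
  · rintro ⟨h1, h2, h3⟩
    obtain ⟨c, hc⟩ := exists_isCut_of_sat_rvalid hD hw h1
    have hα := (hc.sat_avalid hD hw).1 h2
    exact ⟨c, hc, hα, (hc.sat_bvalid hD hw hα).1 h3⟩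

end Checks

end RegionTemplate

/-! ### Modal formulas as segments of the word. -/

namespace TLFP

variable {σ : Type*} {w : List σ} {φ : TLFP σ}

theorem IsDPos.sat_F_iff {q k : ℕ} (h : IsDPos w (F φ) q) (hk : k < w.length) :
    Sat w k (F φ) ↔ k ≤ q := by
  constructor
  · intro hs
    by_contra hc
    exact h.2.2 k (not_le.1 hc) hk hs
  · intro hle
    obtain ⟨j, hj, h'⟩ := h.2.1
    exact ⟨j, by omega, h'⟩

theorem IsDPos.sat_P_iff {q k : ℕ} (h : IsDPos w (P φ) q) : Sat w k (P φ) ↔ q ≤ k := by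
  constructor
  · intro hs
    by_contra hc
    exact h.2.2 k (not_le.1 hc) hs
  · intro hle
    obtain ⟨j, hj, h'⟩ := h.2.1
    exact ⟨j, by omega, h'⟩

/-- The defining position is one before the last position satisfying `φ`. If that last position is
the first of the word, `F φ` is undefined, exactly as `Y1` fails there. -/
theorem isDPos_F_iff {j : ℕ} : IsDPos w (F φ) j ↔
    j + 1 < w.length ∧ Sat w (j + 1) φ ∧ ∀ k, j + 1 < k → k < w.length → ¬ Sat w k φ := by
  constructor
  · rintro ⟨h1, ⟨k, hk, hk', hs⟩, h3⟩
    have hkj : k = j + 1 := by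
      by_contra hne
      exact h3 (j + 1) (by omega) (by omega) ⟨k, by omega, hk', hs⟩
    subst hkj
    exact ⟨hk', hs, fun k hjk hk hs => h3 (j + 1) (by omega) hk' ⟨k, hjk, hk, hs⟩⟩
  · rintro ⟨h1, h2, h3⟩
    refine ⟨by omega, ⟨j + 1, by omega, h1, h2⟩, ?_⟩
    rintro k hk hk' ⟨n, hn, hn', hs⟩
    exact h3 n (by omega) hn' hs

theorem isDPos_P_iff {j : ℕ} : IsDPos w (P φ) j ↔
    ∃ i, j = i + 1 ∧ j < w.length ∧ Sat w i φ ∧ ∀ k < i, ¬ Sat w k φ := by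
  constructor
  · rintro ⟨h1, ⟨k, hk, hs⟩, h3⟩
    have hkj : j = k + 1 := by
      by_contra hne
      exact h3 (k + 1) (by omega) ⟨k, by omega, hs⟩
    subst hkj
    exact ⟨k, rfl, h1, hs, fun n hn hs => h3 k (by omega) ⟨n, hn, hs⟩⟩
  · rintro ⟨i, rfl, h1, h2, h3⟩
    refine ⟨h1, ⟨i, by omega, h2⟩, ?_⟩
    rintro k hk ⟨n, hn, hs⟩
    exact h3 n (by omega) hs

end TLFP

/-! ### Correctness of the ranker of one modal formula. -/

namespace RegionTemplate

open Ranker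

variable {σ : Type*} {κ : Finset (TLFP σ)} {R : RegionTemplate κ} {D : κ → Ranker σ}
  {w : List σ} {c : ℕ → ℕ}

theorem mem_reg (R : RegionTemplate κ) (ζ : κ) : ζ ∈ R.τ (R.reg ζ) :=
  (R.unique ζ).choose_spec.1

theorem IsCut.exists_region (hc : IsCut R w c) {k : ℕ} (hk : k < w.length) :
    ∃ i : Fin R.m, c i ≤ k ∧ k < c (i + 1) := by
  have hex : ∃ n, k < c n := ⟨R.m, hc.last ▸ hk⟩
  classical
  have h1 := Nat.find_spec hex
  have h0 : Nat.find hex ≠ 0 := fun h => by rw [h, hc.zero] at h1; omega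
  have h2 := Nat.find_min hex (m := Nat.find hex - 1) (by omega)
  have h3 : Nat.find hex ≤ R.m := Nat.find_min' hex (hc.last ▸ hk)
  refine ⟨⟨Nat.find hex - 1, by omega⟩, not_lt.1 h2, ?_⟩
  simp only [Nat.sub_add_cancel (Nat.pos_of_ne_zero h0)]
  exact h1

theorem IsCut.le_of_mem (hc : IsCut R w c) {i j : Fin R.m} {k l : ℕ} (hi : c i ≤ k)
    (hj : l < c (j + 1)) (hkl : k ≤ l) : i ≤ j := by
  by_contra hn
  have hn' : j.val + 1 ≤ i.val := not_le.1 hn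
  have := hc.mono hn' i.2.le
  omega

theorem IsCut.isDPos_reg (hc : IsCut R w c) (ζ : κ) :
    TLFP.IsDPos w ζ.1 (c (R.reg ζ)) ∧ c (R.reg ζ + 1) = c (R.reg ζ) + 1 :=
  ⟨(hc.isDPos _ ⟨ζ, R.mem_reg ζ⟩).2 ζ (R.mem_reg ζ), (hc.isDPos _ ⟨ζ, R.mem_reg ζ⟩).1⟩

variable [DecidableEq σ]

theorem defAt_subset (R : RegionTemplate κ) (φ : TLFP σ) (i : Fin R.m) :
    R.defAt φ i ⊆ R.alpha i := by
  induction φ with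
  | letter a => exact Finset.inter_subset_left
  | or φ₁ φ₂ h₁ h₂ => exact Finset.union_subset h₁ h₂
  | not φ ih => exact Finset.sdiff_subset
  | F φ ih => unfold defAt; split_ifs <;> simp
  | P φ ih => unfold defAt; split_ifs <;> simp

/-- Defining positions are region borders, so comparing a position with one of them is the same as
comparing regions. Components outside `κ` are undefined and hold nowhere. The induction stops at the
outermost modalities. -/
theorem IsCut.sat_iff_mem_defAt (hc : IsCut R w c) (hα : IsAlphabet R w c) {φ : TLFP σ}
    (hφ : ∀ ζ ∈ φ.components, ζ ∈ κ ↔ ζ.Defined w) {i : Fin R.m} {k : ℕ} {a : σ}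
    (h1 : c i ≤ k) (h2 : k < c (i + 1)) (ha : w[k]? = some a) :
    φ.Sat w k ↔ a ∈ R.defAt φ i := by
  have haα : a ∈ R.alpha i := (hα i a).2 ⟨k, h1, h2, ha⟩
  have hk : k < w.length := (List.getElem?_eq_some_iff.1 ha).1
  induction φ with
  | letter b => simp [TLFP.Sat, defAt, haα, ha]
  | or φ₁ φ₂ ih₁ ih₂ =>
    simp only [TLFP.Sat, defAt, Finset.mem_union]
    exact or_congr (ih₁ fun ζ hζ => hφ ζ (Finset.mem_union_left _ hζ))
      (ih₂ fun ζ hζ => hφ ζ (Finset.mem_union_right _ hζ))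
  | not φ ih =>
    simp only [TLFP.Sat, defAt, Finset.mem_sdiff, haα, true_and]
    exact not_congr (ih hφ)
  | F φ ih =>
    have hdef := hφ (.F φ) (by simp [TLFP.components])
    rw [defAt]
    split_ifs with h
    · obtain ⟨hm, hle⟩ := h
      obtain ⟨hd, hs⟩ := hc.isDPos_reg ⟨_, hm⟩
      simp only [haα, iff_true]
      rw [hd.sat_F_iff hk]
      -- In the formula's own region the comparison with its defining position works because an
      -- F-region has one position.
      rcases hle.lt_or_eq with hlt | heq
      · have := hc.mono (i := i.val + 1) hlt (R.reg ⟨_, hm⟩).2.le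
        omega
      · rw [← heq] at hs ⊢
        omega
    · simp only [Finset.notMem_empty, iff_false]
      intro hsat
      have hm := hdef.2 ⟨k, hk, hsat⟩
      obtain ⟨hd, hs⟩ := hc.isDPos_reg ⟨_, hm⟩
      exact h ⟨hm, hc.le_of_mem h1 (by omega) ((hd.sat_F_iff hk).1 hsat)⟩
  | P φ ih =>
    have hdef := hφ (.P φ) (by simp [TLFP.components])
    rw [defAt]
    split_ifs with h
    · obtain ⟨hm, hle⟩ := h
      obtain ⟨hd, hs⟩ := hc.isDPos_reg ⟨_, hm⟩
      simp only [haα, iff_true]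
      rw [hd.sat_P_iff]
      exact (hc.mono hle i.2.le).trans h1
    · simp only [Finset.notMem_empty, iff_false]
      intro hsat
      have hm := hdef.2 ⟨k, hk, hsat⟩
      obtain ⟨hd, hs⟩ := hc.isDPos_reg ⟨_, hm⟩
      exact h ⟨hm, hc.le_of_mem le_rfl h2 (hd.sat_P_iff.1 hsat)⟩

theorem mem_defRegions {φ : TLFP σ} {i : Fin R.m} :
    i ∈ R.defRegions φ ↔ (R.defAt φ i).Nonempty := by
  simp [defRegions]

theorem IsCut.exists_mem_defRegions (hc : IsCut R w c) (hα : IsAlphabet R w c) {φ : TLFP σ}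
    (hφ : ∀ ζ ∈ φ.components, ζ ∈ κ ↔ ζ.Defined w) {k : ℕ} (hk : k < w.length)
    (hs : φ.Sat w k) : ∃ i : Fin R.m, ∃ a, i ∈ R.defRegions φ ∧ c i ≤ k ∧ k < c (i + 1) ∧
      w[k]? = some a ∧ a ∈ R.defAt φ i := by
  obtain ⟨i, h1, h2⟩ := hc.exists_region hk
  have ha := List.getElem?_eq_getElem hk
  have hm := (hc.sat_iff_mem_defAt hα hφ h1 h2 ha).1 hs
  exact ⟨i, _, mem_defRegions.2 ⟨_, hm⟩, h1, h2, ha, hm⟩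

/-- The ranker without its final `Y1` stops at the last position satisfying `φ`: no later region
contains such a position, and `<^R` singles out the last one inside the region. -/
theorem IsCut.run_rankerStep_F (hc : IsCut R w c) (hα : IsAlphabet R w c)
    (hright : ∀ i : Fin R.m, (R.right i).Pairwise (RightBefore w (c i) (c (i + 1))))
    (hD : Locates D w) (hw : w ≠ []) {φ : TLFP σ}
    (hφ : ∀ ζ ∈ φ.components, ζ ∈ κ ↔ ζ.Defined w) {j : ℕ} :
    Run w (R.rankerStep D (.F φ)) 0 j ↔ TLFP.IsDPos w (.F φ) j := by
  rw [TLFP.isDPos_F_iff]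
  by_cases h : (R.defRegions φ).Nonempty
  swap
  · rw [rankerStep, dif_neg h]
    refine ⟨fun h' => absurd h' not_run_u, fun ⟨h1, h2, _⟩ => ?_⟩
    obtain ⟨i, a, hi, -⟩ := hc.exists_mem_defRegions hα hφ h1 h2
    exact absurd ⟨i, hi⟩ h
  suffices ∃ s q, R.rankerStep D (.F φ) = s ++ [.Y1] ∧ Run w s 0 q ∧ φ.Sat w q ∧
      ∀ k, q < k → k < w.length → ¬ φ.Sat w k by
    obtain ⟨s, q, hs, hq, hsat, hlast⟩ := this
    have hl := hq.lt_length (List.length_pos_iff.2 hw)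
    rw [hs, run_append]
    simp only [run_singleton]
    constructor
    · rintro ⟨k, hk, rfl, -⟩
      obtain rfl := hq.unique hk
      exact ⟨hl, hsat, hlast⟩
    · rintro ⟨h1, h2, h3⟩
      refine ⟨q, hq, ?_, by omega⟩
      rcases lt_trichotomy (j + 1) q with hlt | heq | hgt
      · exact absurd hsat (h3 q hlt hl)
      · exact heq
      · exact absurd h2 (hlast _ hgt h1)
  have hmem := (R.defRegions φ).max'_mem h
  -- Maximality of the region confines all positions satisfying `φ` to the left of its right border.
  have hmax : ∀ k < w.length, φ.Sat w k → k < c ((R.defRegions φ).max' h + 1) := by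
    intro k hk hs
    obtain ⟨i, a, hi, -, h2, -⟩ := hc.exists_mem_defRegions hα hφ hk hs
    have hle : i.val ≤ ((R.defRegions φ).max' h).val := (R.defRegions φ).le_max' i hi
    exact lt_of_lt_of_le h2 (hc.mono (Nat.succ_le_succ hle) ((R.defRegions φ).max' h).2)
  rw [rankerStep, dif_pos h]
  generalize (R.defRegions φ).max' h = r at hmem hmax ⊢
  obtain ⟨a, ha⟩ := mem_defRegions.1 hmem
  by_cases hr : (R.τ r).Nonempty
  · obtain ⟨k, h1, h2, hk⟩ := (hα r a).1 (R.defAt_subset φ r ha)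
    have hs := (hc.isDPos r hr).1
    refine ⟨_, c r, by simp only [if_pos hr], hc.run_regRanker hD hr, ?_, ?_⟩
    · obtain rfl : k = c r := by omega
      exact (hc.sat_iff_mem_defAt hα hφ h1 h2 hk).2 ha
    · intro k hk hk' hsat
      have := hmax k hk' hsat
      omega
  · have hfind : ∃ p, (R.right r).find? (fun a => a ∈ R.defAt φ r) = some p := by
      rw [← Option.isSome_iff_exists, List.find?_isSome]
      exact ⟨a, (R.mem_right r a).2 (R.defAt_subset φ r ha), by simpa using ha⟩
    obtain ⟨p, hp⟩ := hfind
    obtain ⟨hpd, as, bs, hsplit, has⟩ := List.find?_eq_some_iff_append.1 hp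
    have hpd' : p ∈ R.defAt φ r := by simpa using hpd
    obtain ⟨k, h1, h2, hk⟩ := (hα r p).1 (R.defAt_subset φ r hpd')
    obtain ⟨q, hkq, hqu, hqp, hqn⟩ := exists_last_letter h2 hk
    refine ⟨R.fromRight D r p, q, by simp only [if_neg hr, hp],
      (hc.run_fromRight hD hw hr).2 ⟨hqu, hqp, hqn⟩,
      (hc.sat_iff_mem_defAt hα hφ (h1.trans hkq) hqu hqp).2 hpd', ?_⟩
    intro n hn hn' hsat
    have hnu := hmax n hn' hsat
    have hb := List.getElem?_eq_getElem hn'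
    have hbd := (hc.sat_iff_mem_defAt hα hφ (by omega) hnu hb).1 hsat
    have hbr := (R.mem_right r _).2 (R.defAt_subset φ r hbd)
    have hpw := hright r
    rw [hsplit] at hbr hpw
    -- A position beyond `q` satisfying `φ` carries a letter of `right r`. Before `p` in this list,
    -- the letter contradicts the choice of `p`; equal to `p`, it contradicts that `q` is the last
    -- `p`; after `p`, it contradicts `<^R`.
    rcases List.mem_append.1 hbr with hba | hbp
    · simpa [hbd] using has _ hba
    rcases List.mem_cons.1 hbp with hbp | hbb
    · exact hqn n hn hnu (hbp ▸ hb)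
    · obtain ⟨x, hx1, hx2, hx3, hx4⟩ :=
        (List.pairwise_cons.1 (List.pairwise_append.1 hpw).2.1).1 _ hbb
      have hxq : x ≤ q := by
        by_contra hxq
        exact hqn x (not_le.1 hxq) hx2 hx3
      exact hx4 n (by omega) hnu hb

/-- Mirror image: least region, `<^L`, and a final `X1`, which fails exactly when the first position
satisfying `φ` ends the word. -/
theorem IsCut.run_rankerStep_P (hc : IsCut R w c) (hα : IsAlphabet R w c)
    (hleft : ∀ i : Fin R.m, (R.left i).Pairwise (LeftBefore w (c i) (c (i + 1))))
    (hD : Locates D w) (hw : w ≠ []) {φ : TLFP σ}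
    (hφ : ∀ ζ ∈ φ.components, ζ ∈ κ ↔ ζ.Defined w) {j : ℕ} :
    Run w (R.rankerStep D (.P φ)) 0 j ↔ TLFP.IsDPos w (.P φ) j := by
  rw [TLFP.isDPos_P_iff]
  by_cases h : (R.defRegions φ).Nonempty
  swap
  · rw [rankerStep, dif_neg h]
    refine ⟨fun h' => absurd h' not_run_u, fun ⟨i, hji, h1, h2, _⟩ => ?_⟩
    obtain ⟨i, a, hi, -⟩ := hc.exists_mem_defRegions hα hφ (by omega) h2
    exact absurd ⟨i, hi⟩ h
  suffices ∃ s q, R.rankerStep D (.P φ) = s ++ [.X1] ∧ Run w s 0 q ∧ φ.Sat w q ∧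
      ∀ k < q, ¬ φ.Sat w k by
    obtain ⟨s, q, hs, hq, hsat, hfirst⟩ := this
    rw [hs, run_append]
    simp only [run_singleton]
    constructor
    · rintro ⟨k, hk, rfl, hl⟩
      obtain rfl := hq.unique hk
      exact ⟨q, rfl, hl, hsat, hfirst⟩
    · rintro ⟨i, rfl, h1, h2, h3⟩
      refine ⟨q, hq, ?_, h1⟩
      rcases lt_trichotomy i q with hlt | heq | hgt
      · exact absurd h2 (hfirst i hlt)
      · rw [heq]
      · exact absurd hsat (h3 _ hgt)
  have hmem := (R.defRegions φ).min'_mem h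
  have hmin : ∀ k < w.length, φ.Sat w k → c ((R.defRegions φ).min' h) ≤ k := by
    intro k hk hs
    obtain ⟨i, a, hi, h1, -⟩ := hc.exists_mem_defRegions hα hφ hk hs
    have hle : ((R.defRegions φ).min' h).val ≤ i.val := (R.defRegions φ).min'_le i hi
    exact (hc.mono hle i.2.le).trans h1
  rw [rankerStep, dif_pos h]
  generalize (R.defRegions φ).min' h = r at hmem hmin ⊢
  obtain ⟨a, ha⟩ := mem_defRegions.1 hmem
  by_cases hr : (R.τ r).Nonempty
  · obtain ⟨k, h1, h2, hk⟩ := (hα r a).1 (R.defAt_subset φ r ha)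
    have hs := (hc.isDPos r hr).1
    obtain rfl : k = c r := by omega
    refine ⟨_, c r, by simp only [if_pos hr], hc.run_regRanker hD hr,
      (hc.sat_iff_mem_defAt hα hφ h1 h2 hk).2 ha, ?_⟩
    intro n hn hsat
    have hkl := (List.getElem?_eq_some_iff.1 hk).1
    have := hmin n (by omega) hsat
    omega
  · have hfind : ∃ p, (R.left r).find? (fun a => a ∈ R.defAt φ r) = some p := by
      rw [← Option.isSome_iff_exists, List.find?_isSome]
      exact ⟨a, (R.mem_left r a).2 (R.defAt_subset φ r ha), by simpa using ha⟩
    obtain ⟨p, hp⟩ := hfind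
    obtain ⟨hpd, as, bs, hsplit, has⟩ := List.find?_eq_some_iff_append.1 hp
    have hpd' : p ∈ R.defAt φ r := by simpa using hpd
    obtain ⟨k, h1, h2, hk⟩ := (hα r p).1 (R.defAt_subset φ r hpd')
    obtain ⟨q, hq, hqk, hqp, hqn⟩ := exists_first_letter h1 hk
    refine ⟨R.fromLeft D r p, q, by simp only [if_neg hr, hp],
      (hc.run_fromLeft hD hw hr).2 ⟨hq, hqp, hqn⟩,
      (hc.sat_iff_mem_defAt hα hφ hq (by omega) hqp).2 hpd', ?_⟩
    intro n hn hsat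
    have hql := (List.getElem?_eq_some_iff.1 hqp).1
    have hn' : n < w.length := by omega
    have hnl := hmin n hn' hsat
    have hb := List.getElem?_eq_getElem hn'
    have hbd := (hc.sat_iff_mem_defAt hα hφ hnl (by omega) hb).1 hsat
    have hbr := (R.mem_left r _).2 (R.defAt_subset φ r hbd)
    have hpw := hleft r
    rw [hsplit] at hbr hpw
    rcases List.mem_append.1 hbr with hba | hbp
    · simpa [hbd] using has _ hba
    rcases List.mem_cons.1 hbp with hbp | hbb
    · exact hqn n hnl hn (hbp ▸ hb)
    · obtain ⟨x, hx1, hx2, hx3, hx4⟩ :=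
        (List.pairwise_cons.1 (List.pairwise_append.1 hpw).2.1).1 _ hbb
      have hxq : q ≤ x := by
        by_contra hxq
        exact hqn x hx1 (not_le.1 hxq) hx3
      exact hx4 n hnl (by omega) hb

end RegionTemplate

/-! ### Existence of region templates. -/

namespace RegionTemplate

variable {σ : Type*} {κ : Finset (TLFP σ)} {w : List σ}

theorem exists_list_leftBefore {l u : ℕ} (s : Finset σ)
    (hs : ∀ a ∈ s, ∃ k, l ≤ k ∧ k < u ∧ w[k]? = some a) :
    ∃ L : List σ, L.Nodup ∧ (∀ a, a ∈ L ↔ a ∈ s) ∧ L.Pairwise (LeftBefore w l u) := by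
  classical
  have hf : ∀ a, ∃ j, a ∈ s → l ≤ j ∧ j < u ∧ w[j]? = some a ∧
      ∀ n, l ≤ n → n < j → w[n]? ≠ some a := by
    intro a
    by_cases ha : a ∈ s
    · obtain ⟨k, h1, h2, h3⟩ := hs a ha
      obtain ⟨j, hj, hjk, h⟩ := exists_first_letter h1 h3
      exact ⟨j, fun _ => ⟨hj, by omega, h⟩⟩
    · exact ⟨0, fun h => absurd h ha⟩
  choose f hf using hf
  clear hs
  -- The letters are sorted by first occurrence: the added letter has the largest value of `f`, and
  -- it goes to the end of the list. Distinct letters have distinct values, which makes the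
  -- comparison strict.
  induction s using Finset.induction_on_max_value f with
  | empty => exact ⟨[], by simp⟩
  | insert a s ha hmax ih =>
    obtain ⟨L, h1, h2, h3⟩ := ih fun x hx => hf x (Finset.mem_insert_of_mem hx)
    refine ⟨L ++ [a], ?_, ?_, ?_⟩
    · rw [← List.concat_eq_append]
      exact h1.concat fun h => ha ((h2 a).1 h)
    · intro x
      simp [h2, or_comm]
    · refine List.pairwise_append.2 ⟨h3, List.pairwise_singleton _ _, fun x hx y hy => ?_⟩
      obtain rfl := List.mem_singleton.1 hy
      have hxs := (h2 x).1 hx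
      obtain ⟨g1, g2, g3, -⟩ := hf x (Finset.mem_insert_of_mem hxs)
      obtain ⟨e1, e2, e3, e4⟩ := hf y (Finset.mem_insert_self _ _)
      have hne : f x ≠ f y := fun h => by
        rw [h, e3] at g3
        exact ha (Option.some.inj g3 ▸ hxs)
      have hle := hmax x hxs
      exact ⟨f x, g1, g2, g3, fun n hn hn' => e4 n hn (by omega)⟩

theorem exists_list_rightBefore {l u : ℕ} (s : Finset σ)
    (hs : ∀ a ∈ s, ∃ k, l ≤ k ∧ k < u ∧ w[k]? = some a) :
    ∃ L : List σ, L.Nodup ∧ (∀ a, a ∈ L ↔ a ∈ s) ∧ L.Pairwise (RightBefore w l u) := by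
  classical
  have hf : ∀ a, ∃ j, a ∈ s → l ≤ j ∧ j < u ∧ w[j]? = some a ∧
      ∀ n, j < n → n < u → w[n]? ≠ some a := by
    intro a
    by_cases ha : a ∈ s
    · obtain ⟨k, h1, h2, h3⟩ := hs a ha
      obtain ⟨j, hj, hjk, h⟩ := exists_last_letter h2 h3
      exact ⟨j, fun _ => ⟨by omega, hjk, h⟩⟩
    · exact ⟨0, fun h => absurd h ha⟩
  choose f hf using hf
  clear hs
  -- Here `f` gives last occurrences, so the letter with the largest value is reached first from the
  -- right and goes to the front.
  induction s using Finset.induction_on_max_value f with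
  | empty => exact ⟨[], by simp⟩
  | insert a s ha hmax ih =>
    obtain ⟨L, h1, h2, h3⟩ := ih fun x hx => hf x (Finset.mem_insert_of_mem hx)
    refine ⟨a :: L, List.nodup_cons.2 ⟨fun h => ha ((h2 a).1 h), h1⟩, ?_,
      List.pairwise_cons.2 ⟨fun x hx => ?_, h3⟩⟩
    · intro x
      simp [h2]
    · have hxs := (h2 x).1 hx
      obtain ⟨g1, g2, g3, g4⟩ := hf x (Finset.mem_insert_of_mem hxs)
      obtain ⟨e1, e2, e3, e4⟩ := hf a (Finset.mem_insert_self _ _)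
      have hne : f x ≠ f a := fun h => by
        rw [h, e3] at g3
        exact ha (Option.some.inj g3 ▸ hxs)
      have hle := hmax x hxs
      exact ⟨f a, e1, e2, e3, fun n hn hn' => g4 n (by omega) hn'⟩

/-- If all formulas of `κ` are defined in `w`, then `w` has a region template for `κ`. -/
theorem exists_isTemplateOf (h : ∀ ζ ∈ κ, ∃ i, TLFP.IsDPos w ζ i) :
    ∃ R : RegionTemplate κ, R.IsTemplateOf w := by
  classical
  choose pos hpos using fun ζ : κ => h ζ.1 ζ.2
  let S : Finset ℕ := Finset.univ.image pos
  -- Several formulas may share a defining position, so `k` counts distinct positions; the template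
  -- has `2 * k + 1` regions, the odd ones being the F-regions. The I-regions may be empty
  -- intervals.
  let k := S.card
  let e := S.orderEmbOfFin (k := k) rfl
  have heS : ∀ j, ∃ ζ, pos ζ = e j := fun j => by
    obtain ⟨ζ, -, hζ⟩ := Finset.mem_image.1 (S.orderEmbOfFin_mem rfl j)
    exact ⟨ζ, hζ⟩
  have hex : ∀ ζ, ∃ j, pos ζ = e j := fun ζ => by
    have h1 : pos ζ ∈ Set.range e := by
      rw [S.range_orderEmbOfFin rfl]
      simp [S]
    obtain ⟨j, hj⟩ := h1
    exact ⟨j, hj.symm⟩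
  -- The extra value at `k` is the length of the word, so that the last I-region ends there.
  let f : ℕ → ℕ := fun j => if hj : j < k then e ⟨j, hj⟩ else w.length
  have hfe : ∀ j (hj : j < k), f j = e ⟨j, hj⟩ := fun j hj => dif_pos hj
  have hfk : f k = w.length := dif_neg (lt_irrefl k)
  have hflt : ∀ j, j < k → f j < w.length := fun j hj => by
    obtain ⟨ζ, hζ⟩ := heS ⟨j, hj⟩
    rw [hfe j hj, ← hζ]
    exact (hpos ζ).lt_length
  have hfmono : ∀ i j, i < j → j ≤ k → f i < f j := fun i j hij hj => by
    rcases hj.lt_or_eq with hj | rfl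
    · rw [hfe i (hij.trans hj), hfe j hj]
      exact e.strictMono hij
    · rw [hfk]
      exact hflt i hij
  -- Odd `n` starts an F-region at its defining position; even `n > 0` starts an I-region just after
  -- the preceding one.
  let c : ℕ → ℕ := fun n => if n % 2 = 1 then f (n / 2) else if n = 0 then 0 else f (n / 2 - 1) + 1
  have hcodd : ∀ n, n % 2 = 1 → c n = f (n / 2) ∧ c (n + 1) = f (n / 2) + 1 := fun n hn => by
    have h1 : (n + 1) % 2 ≠ 1 := by omega
    have h2 : (n + 1) / 2 - 1 = n / 2 := by omega
    simp only [c, if_pos hn, if_neg h1, h2]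
    simp
  let τ : Fin (2 * k + 1) → Finset κ := fun i =>
    if i.val % 2 = 1 then Finset.univ.filter fun ζ => pos ζ = f (i.val / 2) else ∅
  have hmemτ : ∀ i ζ, ζ ∈ τ i ↔ i.val % 2 = 1 ∧ pos ζ = f (i.val / 2) := fun i ζ => by
    simp only [τ]
    split_ifs with hi <;> simp [hi]
  have hτ : ∀ i, (τ i).Nonempty ↔ i.val % 2 = 1 := fun i => by
    constructor
    · rintro ⟨ζ, hζ⟩
      exact ((hmemτ i ζ).1 hζ).1
    · intro hi
      have hik : i.val / 2 < k := by have := i.2; omega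
      obtain ⟨ζ, hζ⟩ := heS ⟨_, hik⟩
      exact ⟨ζ, (hmemτ i ζ).2 ⟨hi, hζ.trans (hfe _ hik).symm⟩⟩
  let alpha : Fin (2 * k + 1) → Finset σ := fun i =>
    w.toFinset.filter fun a => ∃ n, c i ≤ n ∧ n < c (i + 1) ∧ w[n]? = some a
  have hα : ∀ i a, a ∈ alpha i ↔ ∃ n, c i ≤ n ∧ n < c (i + 1) ∧ w[n]? = some a := fun i a => by
    simp only [alpha, Finset.mem_filter, List.mem_toFinset, and_iff_right_iff_imp]
    rintro ⟨n, -, -, hn⟩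
    exact List.mem_of_getElem? hn
  choose left hl1 hl2 hl3 using fun i => exists_list_leftBefore (alpha i) fun a => (hα i a).1
  choose right hr1 hr2 hr3 using fun i => exists_list_rightBefore (alpha i) fun a => (hα i a).1
  let R : RegionTemplate κ :=
    { m := 2 * k + 1
      m_pos := Nat.succ_pos _
      τ := τ
      alternate := fun i j hij => by rw [hτ, hτ]; omega
      unique := fun ζ => by
        obtain ⟨j, hj⟩ := hex ζ
        refine ⟨⟨2 * j + 1, by omega⟩, (hmemτ _ _).2 ⟨by simp only; omega, ?_⟩, fun i hi => ?_⟩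
        · have h1 : (2 * j.val + 1) / 2 = j.val := by omega
          simp only [h1]
          rw [hj, hfe _ j.2]
        · obtain ⟨h1, h2⟩ := (hmemτ _ _).1 hi
          have hik : i.val / 2 < k := by have := i.2; omega
          rw [hfe _ hik, hj] at h2
          have h3 := congrArg Fin.val (e.injective h2)
          apply Fin.ext
          simp only at h3 ⊢
          omega
      alpha := alpha
      alpha_card := fun i hi => by
        obtain ⟨h1, h2⟩ := hcodd i ((hτ i).1 hi)
        have hik : i.val / 2 < k := by have := i.2; have := (hτ i).1 hi; omega
        have h3 := hflt _ hik
        refine Finset.card_eq_one.2 ⟨w[f (i.val / 2)], Finset.ext fun a => ?_⟩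
        rw [hα, h1, h2, Finset.mem_singleton]
        constructor
        · rintro ⟨n, h4, h5, h6⟩
          obtain rfl : n = f (i.val / 2) := by omega
          rw [List.getElem?_eq_getElem h3] at h6
          exact (Option.some.inj h6).symm
        · rintro rfl
          exact ⟨_, le_rfl, Nat.lt_succ_self _, List.getElem?_eq_getElem h3⟩
      left := left
      left_nodup := hl1
      mem_left := hl2
      right := right
      right_nodup := hr1
      mem_right := hr2 }
  refine ⟨R, isTemplateOf_iff.2 ⟨c, ⟨rfl, ?_, ?_, ?_⟩, hα, hl3, hr3⟩⟩
  · have h1 : (2 * k + 1) / 2 = k := by omega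
    exact (hcodd (2 * k + 1) (by omega)).1.trans (by rw [h1, hfk])
  · intro i
    have hik : i.val < 2 * k + 1 := i.2
    by_cases hi : i.val % 2 = 1
    · rw [(hcodd i hi).1, (hcodd i hi).2]
      omega
    · by_cases h0 : i.val = 0
      · rw [h0]
        exact Nat.zero_le _
      · have h1 := (hcodd (i.val - 1) (by omega)).2
        have h2 := (hcodd (i.val + 1) (by omega)).1
        rw [Nat.sub_add_cancel (by omega)] at h1
        rw [h1, h2]
        exact hfmono _ _ (by omega) (by omega)
  · intro i hi
    obtain ⟨h1, h2⟩ := hcodd i ((hτ i).1 hi)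
    refine ⟨by rw [h1, h2], fun ζ hζ => ?_⟩
    rw [h1, ← ((hmemτ i ζ).1 hζ).2]
    exact hpos ζ

end RegionTemplate

/-! ### Existence of defining positions; the first position of the word. -/

namespace TLFP

variable {σ : Type*} {w : List σ}

theorem Defined.exists_isDPos_F {φ : TLFP σ} (h : Defined w (F φ)) : ∃ i, IsDPos w (F φ) i := by
  classical
  obtain ⟨n, hn, hs⟩ := h
  let q : ℕ → Prop := fun k => k < w.length ∧ Sat w k (F φ)
  have hq : q n := ⟨hn, hs⟩
  have hspec := Nat.findGreatest_spec (P := q) hn.le hq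
  refine ⟨Nat.findGreatest q w.length, hspec.1, hspec.2, fun k hk hk' hks => ?_⟩
  exact absurd (Nat.le_findGreatest (P := q) hk'.le ⟨hk', hks⟩) (not_le.2 hk)

theorem Defined.exists_isDPos_P {φ : TLFP σ} (h : Defined w (P φ)) : ∃ i, IsDPos w (P φ) i := by
  classical
  have hspec := Nat.find_spec h
  refine ⟨Nat.find h, hspec.1, hspec.2, fun k hk hks => ?_⟩
  exact Nat.find_min h hk ⟨hk.trans hspec.1, hks⟩

/-- The truth set of `F φ` is an initial segment, so it is nonempty iff it contains the first
position. Hence acceptance of the ranker of `F φ` decides the formula at the first position. -/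
theorem sat_zero_F_iff {φ : TLFP σ} : Sat w 0 (F φ) ↔ Defined w (F φ) := by
  constructor
  · intro h
    obtain ⟨j, -, hj, -⟩ := id h
    exact ⟨0, by omega, h⟩
  · rintro ⟨i, -, j, hij, hj⟩
    exact ⟨j, by omega, hj⟩

variable [DecidableEq σ]

theorem eq_F_or_P_of_mem_modals {Φ ψ : TLFP σ} (h : ψ ∈ modals Φ) :
    (∃ φ, ψ = F φ) ∨ ∃ φ, ψ = P φ := by
  induction Φ with
  | letter a => simp [modals] at h
  | F φ ih =>
    rcases Finset.mem_insert.1 h with rfl | h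
    · exact Or.inl ⟨φ, rfl⟩
    · exact ih h
  | P φ ih =>
    rcases Finset.mem_insert.1 h with rfl | h
    · exact Or.inr ⟨φ, rfl⟩
    · exact ih h
  | or φ₁ φ₂ h₁ h₂ =>
    rcases Finset.mem_union.1 h with h | h
    · exact h₁ h
    · exact h₂ h
  | not φ ih => exact ih h

theorem Defined.exists_isDPos {Φ ψ : TLFP σ} (hψ : ψ ∈ modals Φ) (h : Defined w ψ) :
    ∃ i, IsDPos w ψ i := by
  rcases eq_F_or_P_of_mem_modals hψ with ⟨φ, rfl⟩ | ⟨φ, rfl⟩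
  · exact h.exists_isDPos_F
  · exact h.exists_isDPos_P

theorem iform_subset_sform {Φ ψ : TLFP σ} (hψ : ψ ∈ modals Φ) : iform ψ ⊆ sform Φ := by
  intro ζ hζ
  refine Finset.mem_erase.2 ⟨?_, modals_trans hψ (iform_subset_modals ψ hζ)⟩
  rintro rfl
  have h1 := size_lt_of_mem_iform hψ hζ
  have h2 := size_le_of_mem_modals hψ
  omega

end TLFP

/-! ### Induction over the modal subformulas. -/

namespace Params

open TLXY Ranker RegionTemplate

variable {σ : Type*} [DecidableEq σ] {Φ : TLFP σ} {p : Params Φ} {w : List σ}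

/-- The ranker `D(ψ)` accepts exactly at the defining position of `ψ`. -/
def RankerCorrect (p : Params Φ) (w : List σ) (ψ : Φ.modals) : Prop :=
  ∀ j, Run w (p.ranker ψ) 0 j ↔ ψ.1.IsDPos w j

theorem RankerCorrect.sat_iff {ψ : Φ.modals} (h : p.RankerCorrect w ψ) :
    Sat w 0 (p.ranker ψ).toTLXY ↔ ψ.1.Defined w := by
  rw [sat_toTLXY]
  exact ⟨fun ⟨j, hj⟩ => ((h j).1 hj).defined, fun hd =>
    (hd.exists_isDPos ψ.2).imp fun j hj => (h j).2 hj⟩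

theorem ranker_eq (p : Params Φ) (ψ : Φ.modals) :
    p.ranker ψ = (p.θ ψ).rankerStep (p.innerRanker ψ) ψ.1 := by
  rw [ranker]
  rfl

theorem locates_innerRanker {ψ : Φ.modals}
    (h : ∀ ζ : Φ.modals, ζ.1 ∈ ψ.1.iform → p.RankerCorrect w ζ) :
    Locates (p.innerRanker ψ) w :=
  fun ζ => h ⟨ζ.1, _⟩ (Finset.mem_inter.1 ζ.2).1

/-- The induction step. `Δ` need only be right on the immediate subformulas of `ψ`, so the step
applies before conformity is known. -/
theorem rankerCorrect_of_isTemplateOf {ψ : Φ.modals} (hw : w ≠ [])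
    (hΔ : ∀ ζ ∈ ψ.1.iform, ζ ∈ p.Δ ↔ ζ.Defined w)
    (h : ∀ ζ : Φ.modals, ζ.1 ∈ ψ.1.iform → p.RankerCorrect w ζ)
    (ht : (p.θ ψ).IsTemplateOf w) : p.RankerCorrect w ψ := by
  obtain ⟨c, hc, hα, hl, hr⟩ := isTemplateOf_iff.1 ht
  have hD := locates_innerRanker h
  intro j
  rw [p.ranker_eq]
  obtain ⟨ψ, hψ⟩ := ψ
  have hκ : ∀ ζ ∈ ψ.iform, ζ ∈ ψ.iform ∩ p.Δ ↔ ζ.Defined w := fun ζ hζ => by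
    rw [Finset.mem_inter, ← hΔ ζ hζ]
    exact and_iff_right hζ
  rcases TLFP.eq_F_or_P_of_mem_modals hψ with ⟨φ, rfl⟩ | ⟨φ, rfl⟩
  · exact hc.run_rankerStep_F hα hr hD hw hκ
  · exact hc.run_rankerStep_P hα hl hD hw hκ

theorem forall_of_forall_iform {C : Φ.modals → Prop}
    (step : ∀ ψ : Φ.modals, (∀ ζ : Φ.modals, ζ.1 ∈ ψ.1.iform → C ζ) → C ψ) (ψ : Φ.modals) : C ψ := by
  induction hn : ψ.1.size using Nat.strong_induction_on generalizing ψ with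
  | _ n ih =>
    subst hn
    exact step ψ fun ζ hζ => ih _ (TLFP.size_lt_of_mem_iform ψ.2 hζ) ζ rfl

theorem Conforms.rankerCorrect (h : p.Conforms w) (hw : w ≠ []) (ψ : Φ.modals) :
    p.RankerCorrect w ψ := by
  refine forall_of_forall_iform (fun ψ ih => ?_) ψ
  exact rankerCorrect_of_isTemplateOf hw
    (fun ζ hζ => h.1 ζ (TLFP.iform_subset_sform ψ.2 hζ)) ih (h.2 ψ)

theorem sat_dvalid_iff : Sat w 0 p.dvalid ↔
    ∀ ψ : Φ.modals, ψ.1 ∈ Φ.sform → (ψ.1 ∈ p.Δ ↔ Sat w 0 (p.ranker ψ).toTLXY) := by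
  simp only [dvalid, sat_and, sat_bigAnd, sat_not, Finset.mem_filter, Finset.mem_attach, true_and,
    Finset.mem_sdiff]
  constructor
  · rintro ⟨h1, h2⟩ ψ hψ
    exact ⟨h1 ψ, fun hs => by_contra fun hn => h2 ψ ⟨hψ, hn⟩ hs⟩
  · intro h
    exact ⟨fun ψ hψ => (h ψ (p.Δ_subset hψ)).1 hψ, fun ψ hψ hs => hψ.2 ((h ψ hψ.1).2 hs)⟩

/-- `Δ` is read off from the word; its members have defining positions, so all the required
templates exist. -/
theorem exists_conforms (Φ : TLFP σ) (w : List σ) : ∃ p : Params Φ, p.Conforms w := by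
  classical
  let Δ := Φ.sform.filter fun ψ => ψ.Defined w
  have ht : ∀ ψ : Φ.modals, ∃ R : RegionTemplate (ψ.1.iform ∩ Δ), R.IsTemplateOf w :=
    fun ψ => exists_isTemplateOf fun ζ hζ => by
      obtain ⟨h1, h2⟩ := Finset.mem_filter.1 (Finset.mem_inter.1 hζ).2
      exact h2.exists_isDPos (Finset.mem_of_mem_erase h1)
  choose θ hθ using ht
  refine ⟨⟨Δ, Finset.filter_subset _ _, θ⟩, fun ψ hψ => ?_, hθ⟩
  simp [Δ, hψ]

theorem Conforms.sat_topLevel (h : p.Conforms w) (hw : w ≠ []) {φ : TLFP σ}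
    (hφ : φ.components ⊆ Φ.modals) : Sat w 0 (p.topLevel φ) ↔ φ.Sat w 0 := by
  induction φ with
  | letter a => exact Iff.rfl
  | or φ₁ φ₂ ih₁ ih₂ =>
    exact or_congr (ih₁ (Finset.union_subset_left hφ)) (ih₂ (Finset.union_subset_right hφ))
  | not φ ih => exact not_congr (ih hφ)
  | F φ ih =>
    have hm : TLFP.F φ ∈ Φ.modals := hφ (by simp [TLFP.components])
    rw [topLevel, dif_pos hm, (h.rankerCorrect hw _).sat_iff, TLFP.sat_zero_F_iff]
  | P φ ih => simp [topLevel, TLFP.Sat]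

variable [Fintype σ]

theorem sat_tvalid_iff : Sat w 0 p.tvalid ↔
    ∀ ψ : Φ.modals, Sat w 0 ((p.θ ψ).rvalid (p.innerRanker ψ)) ∧
      Sat w 0 ((p.θ ψ).avalid (p.innerRanker ψ)) ∧
      Sat w 0 ((p.θ ψ).bvalid (p.innerRanker ψ)) := by
  simp only [tvalid, sat_bigAnd, sat_and, Finset.mem_attach, forall_const]

theorem conforms_iff (hw : w ≠ []) :
    p.Conforms w ↔ Sat w 0 p.dvalid ∧ Sat w 0 p.tvalid := by
  rw [sat_dvalid_iff, sat_tvalid_iff]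
  constructor
  · intro h
    have hr := h.rankerCorrect hw
    refine ⟨fun ψ hψ => (h.1 ψ.1 hψ).trans (hr ψ).sat_iff.symm, fun ψ => ?_⟩
    exact (isTemplateOf_iff_sat (locates_innerRanker fun ζ _ => hr ζ) hw).1 (h.2 ψ)
  · rintro ⟨hd, ht⟩
    -- No circularity arises: the template of `ψ` and membership in `Δ` of its immediate subformulas
    -- are verified using only rankers of smaller formulas.
    have hr : ∀ ψ, p.RankerCorrect w ψ := forall_of_forall_iform fun ψ ih => by
      refine rankerCorrect_of_isTemplateOf hw (fun ζ hζ => ?_) ih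
        ((isTemplateOf_iff_sat (locates_innerRanker ih) hw).2 (ht ψ))
      have hζΦ := TLFP.iform_subset_sform ψ.2 hζ
      let ζ' : Φ.modals := ⟨ζ, Finset.mem_of_mem_erase hζΦ⟩
      exact (hd ζ' hζΦ).trans (ih ζ' hζ).sat_iff
    refine ⟨fun ψ hψ => ?_, fun ψ => ?_⟩
    · let ψ' : Φ.modals := ⟨ψ, Finset.mem_of_mem_erase hψ⟩
      exact (hd ψ' hψ).trans (hr ψ').sat_iff
    · exact (isTemplateOf_iff_sat (locates_innerRanker fun ζ _ => hr ζ) hw).2 (ht ψ)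

end Params

/-! ### The language of the translation and the final statement. -/

theorem language_trans {σ : Type*} [Fintype σ] [DecidableEq σ] (Φ : TLFP σ) :
    (trans Φ).language = Φ.language := by
  ext w
  refine and_congr_right fun hw => ?_
  rw [trans, TLXY.sat_bigOr]
  constructor
  · rintro ⟨p, -, h⟩
    rw [TLXY.sat_and, TLXY.sat_and, ← and_assoc, ← Params.conforms_iff hw] at h
    exact (h.1.sat_topLevel hw Φ.components_subset_modals).1 h.2
  · intro h
    obtain ⟨p, hp⟩ := Params.exists_conforms Φ w
    refine ⟨p, @Finset.mem_univ _ (_) p, ?_⟩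
    rw [TLXY.sat_and, TLXY.sat_and, ← and_assoc, ← Params.conforms_iff hw]
    exact ⟨hp, (hp.sat_topLevel hw Φ.components_subset_modals).2 h⟩

end UL

theorem mainTheorem3 {σ : Type*} [Fintype σ] [DecidableEq σ] (Φ : UL.TLFP σ) :
    (∀ (p : UL.Params Φ) (w : List σ), w ≠ [] →
      (p.Conforms w ↔ w ∈ p.dvalid.language ∧ w ∈ p.tvalid.language)) ∧
    (∀ (p : UL.Params Φ) (ψ : Φ.modals) (w : List σ), w ≠ [] → p.Conforms w →
      ∀ i : ℕ, (p.ranker ψ).AcceptsAt w i ↔ ψ.1.Defined w ∧ ψ.1.IsDPos w i) ∧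
    (UL.trans Φ).language = Φ.language := by
  refine ⟨fun p w hw => ?_, fun p ψ w hw h i => ?_, UL.language_trans Φ⟩
  · rw [UL.Params.conforms_iff hw]
    exact ⟨fun h => ⟨⟨hw, h.1⟩, hw, h.2⟩, fun h => ⟨h.1.2, h.2.2⟩⟩
  · rw [← h.rankerCorrect hw ψ i]
    exact ⟨fun hr => ⟨((h.rankerCorrect hw ψ i).1 hr.2).defined, hr.2⟩, fun hr => ⟨hw, hr.2⟩⟩
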